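/- Let $u$ be a subharmonic function, with values in $[-\infty,\infty)$, on an open neighborhood of a point $a\in\mathbb{C}$, and assume that $u$ is not identically $-\infty$ in any neighborhood of $a$. Put $M(u,a,r)=\max_{|z-a|=r}u(z)$ for small $r>0$. Then the limit $$\nu(u,a)=\lim_{r\to 0^+}\frac{M(u,a,r)}{\log r}$$ (the Lelong number of $u$ at $a$) exists and lies in $[0,\infty)$. Let $$\iota(u,a)=\inf\{t>0:\ e^{-2u/t}\text{ is Lebesgue integrable in some neighborhood of }a\}$$ be the integrability index of $u$ at $a$ (with $e^{-2u/t}=+\infty$ where $u=-\infty$). Then $$\iota(u,a)=\nu(u,a).$$ Moreover, $e^{-2u}$ is integrable in a neighborhood of $a$ if and only if $\nu(u,a)<1$. -/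

import Mathlib

open MeasureTheory Filter Topology

noncomputable section

/-- The integral mean `(1/2π) ∫₀^{2π} u(a + r e^{it}) dt` of an extended-real-valued function,
the integral being that of the positive part minus that of the negative part. For a function
that is bounded above on the circle this is the usual mean, with values in `[-∞, ∞)`. -/
def circleMean (u : ℂ → EReal) (a : ℂ) (r : ℝ) : EReal :=
  (((2 * Real.pi)⁻¹ : ℝ) : EReal) *
    (((∫⁻ t in Set.Ioc 0 (2 * Real.pi), (u (circleMap a r t)).toENNReal : ENNReal) : EReal) -
      ((∫⁻ t in Set.Ioc 0 (2 * Real.pi), (-u (circleMap a r t)).toENNReal : ENNReal) : EReal))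

/-- Subharmonic functions `u : U → [-∞, ∞)` on an open set `U`: upper semicontinuity and the
local submean inequality. The function `u ≡ -∞` is allowed here. Values of `u` off `U` are
irrelevant. -/
structure SubharmonicOn (u : ℂ → EReal) (U : Set ℂ) : Prop where
  lt_top : ∀ z ∈ U, u z < ⊤
  upperSemicontinuousOn : UpperSemicontinuousOn u U
  submean : ∀ w ∈ U, ∃ ρ > 0, Metric.ball w ρ ⊆ U ∧
    ∀ r : ℝ, 0 < r → r < ρ → u w ≤ circleMean u w r

/-- `M(u, a, r)`, the maximum of `u` on the circle `|z - a| = r`. -/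
def circleMax (u : ℂ → EReal) (a : ℂ) (r : ℝ) : EReal :=
  ⨆ z ∈ Metric.sphere a r, u z

/-- The Lelong number `ν(u, a) = lim_{r → 0⁺} M(u, a, r) / log r`. -/
def lelongNumber (u : ℂ → EReal) (a : ℂ) : EReal :=
  limUnder (𝓝[>] (0 : ℝ)) fun r => circleMax u a r / ((Real.log r : ℝ) : EReal)

/-- A `[0, ∞]`-valued function has finite Lebesgue integral over some neighborhood of `a`. -/
def IntegrableNear (f : ℂ → ENNReal) (a : ℂ) : Prop :=
  ∃ V ∈ 𝓝 a, ∫⁻ z in V, f z < ⊤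

/-- The integrability index `ι(u, a)`, the infimum in `[-∞, ∞]` of all real `t > 0` for which
`exp (-2u/t)` is integrable in some neighborhood of `a`. -/
def integrabilityIndex (u : ℂ → EReal) (a : ℂ) : EReal :=
  ⨅ (t : ℝ) (_ : 0 < t ∧ IntegrableNear (fun z => (-(2 * u z) / (t : EReal)).exp) a), (t : EReal)

end

/-! Everything reduces to one equivalence: for `t > 0`, `e^{-2u/t}` is integrable near `a` if and
only if `ν < t`. Taking the infimum over `t` gives the index, and `t = 1` gives the last claim.

Existence of `ν`: by the maximum principle on discs and annuli, `M(u,a,r)` is increasing and is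
convex in `log r` (Hadamard's three circles). Its secant slopes from a fixed radius `R` therefore
decrease to a limit `ν ≥ 0` as `r → 0`, and `u ≤ M(R) + ν log(|z-a|/R)` on the punctured disc of
radius `R` about `a` (`SubharmonicOn.exists_lelong`). If `ν ≥ t`, this bound makes `e^{-2u/t}` at
least a constant times `|z-a|^{-2}`, which is not integrable in the plane
(`lelong_lt_of_integrableNear`).

Conversely let `ν < θ < t`. The superharmonic function `f = C - u` has Riesz mass below `θ` on a
small disc. There `f` is a bounded term plus the logarithmic potential of that mass, and Jensen's
inequality bounds `e^{2f/t}` by an average of `|z-w|^{-2θ/t}` over `w`. This is integrable because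
`2θ/t < 2`.

The Riesz measure is never constructed. Write `A_ρ` for the average over discs of radius `ρ`, and
`β_ρ = (1 - A_ρ) log(T/|·|)` (`discKernel`). The operators `A_ρ` and `A_R` commute, so `β_ρ + A_ρ
β_R = β_R + A_R β_ρ` (`discKernel_comm`). Convolving with `f` shows that `β_ρ * f` is `A_R β_ρ * f`
plus the `β_R`-potential of the nonnegative function `f - A_ρ f`, which, divided by `∫ β_ρ`, serves
as a mollified Riesz measure. Its mass is bounded in `mass_le`, the exponential estimate uniform in
`ρ` is `lintegral_expPow_mollify_le`, and Fatou's lemma lets `ρ → 0` (`lintegral_expPow_lt_top`).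
The smallness of the mass comes from disc averages of `f` being at most about `C - M(u,a,r)`, which
is asymptotic to `ν log(1/r)` when `ν > 0`. -/

/-! ### Comparison of subharmonic and harmonic functions -/

lemma circleMean_le_of_le {u : ℂ → EReal} {w : ℂ} {r : ℝ} {φ : ℝ → ℝ}
    (hφ : IntegrableOn φ (Set.Ioc 0 (2 * Real.pi)))
    (h : ∀ t ∈ Set.Ioc 0 (2 * Real.pi), u (circleMap w r t) ≤ (φ t : EReal)) :
    circleMean u w r ≤
      (((2 * Real.pi)⁻¹ * ∫ t in Set.Ioc 0 (2 * Real.pi), φ t : ℝ) : EReal) := by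
  have h1 : (∫⁻ t in Set.Ioc 0 (2 * Real.pi), (u (circleMap w r t)).toENNReal) ≤
      ∫⁻ t in Set.Ioc 0 (2 * Real.pi), ENNReal.ofReal (φ t) := by
    refine setLIntegral_mono' measurableSet_Ioc fun t ht => ?_
    exact EReal.toENNReal_le_toENNReal (h t ht)
  have h2 : (∫⁻ t in Set.Ioc 0 (2 * Real.pi), ENNReal.ofReal (-φ t)) ≤
      ∫⁻ t in Set.Ioc 0 (2 * Real.pi), (-u (circleMap w r t)).toENNReal := by
    refine setLIntegral_mono' measurableSet_Ioc fun t ht => ?_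
    have := EReal.toENNReal_le_toENNReal (EReal.neg_le_neg_iff.2 (h t ht))
    simpa [← EReal.coe_neg] using this
  have h3 : (((∫⁻ t in Set.Ioc 0 (2 * Real.pi), ENNReal.ofReal (φ t) : ENNReal) : EReal) -
      ((∫⁻ t in Set.Ioc 0 (2 * Real.pi), ENNReal.ofReal (-φ t) : ENNReal) : EReal)) =
      ((∫ t in Set.Ioc 0 (2 * Real.pi), φ t : ℝ) : EReal) := by
    rw [integral_eq_lintegral_pos_part_sub_lintegral_neg_part hφ, EReal.coe_sub,
      EReal.coe_ennreal_toReal, EReal.coe_ennreal_toReal]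
    · exact (hφ.neg.lintegral_lt_top).ne
    · exact (hφ.lintegral_lt_top).ne
  unfold circleMean
  rw [EReal.coe_mul, ← h3]
  refine mul_le_mul_of_nonneg_left ?_ (by exact_mod_cast (by positivity : (0:ℝ) ≤ (2 * Real.pi)⁻¹))
  exact EReal.sub_le_sub (by exact_mod_cast h1) (by exact_mod_cast h2)

lemma UpperSemicontinuousOn.sub_real {u : ℂ → EReal} {K : Set ℂ} {h : ℂ → ℝ}
    (hu : UpperSemicontinuousOn u K) (hc : ContinuousOn h K) :
    UpperSemicontinuousOn (fun z => u z - (h z : EReal)) K := by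
  have h1 : UpperSemicontinuousOn (fun z => ((-h z : ℝ) : EReal)) K :=
    (continuous_coe_real_ereal.comp_continuousOn hc.neg).upperSemicontinuousOn
  simp only [sub_eq_add_neg, ← EReal.coe_neg]
  refine hu.add' h1 fun x _ => EReal.continuousAt_add ?_ ?_
  · exact Or.inr (EReal.coe_ne_bot _)
  · exact Or.inr (EReal.coe_ne_top _)

/-- If `u - h` fell below its maximum `m` at `w + r`, then by semicontinuity it would stay below `m`
on an arc. The mean of `u` on that circle would then be strictly less than `m + h w = u w`. Only the
points to the right of `w` are recorded, since that suffices for the maximum principle. -/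
lemma SubharmonicOn.not_isMaxOn_of_lt {U : Set ℂ} {u : ℂ → EReal} (hu : SubharmonicOn u U)
    {K : Set ℂ} (hKU : K ⊆ U) {h : ℂ → ℝ} (hc : ContinuousOn h K) {w : ℂ} (hK : K ∈ 𝓝 w)
    (hh : InnerProductSpace.HarmonicAt h w) {m : ℝ} (hw : u w = ((m + h w : ℝ) : EReal))
    (hle : ∀ z ∈ K, u z ≤ ((m + h z : ℝ) : EReal)) :
    ∀ᶠ r : ℝ in 𝓝[>] 0, u (w + r) = ((m + h (w + r) : ℝ) : EReal) := by
  obtain ⟨ρ, hρ, hρU, hmean⟩ := hu.submean w (hKU (mem_of_mem_nhds hK))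
  obtain ⟨ε, hε, hεK⟩ := Metric.mem_nhds_iff.1
    (inter_mem hK ((InnerProductSpace.isOpen_setOfPred_harmonicAt (f := h)).mem_nhds hh))
  filter_upwards [Ioo_mem_nhdsGT (lt_min hρ hε)] with r hr
  have hr0 := hr.1
  have hrρ : r < ρ := hr.2.trans_le (min_le_left _ _)
  have hrε : r < ε := hr.2.trans_le (min_le_right _ _)
  have hball : Metric.closedBall w r ⊆ K ∩ {x | InnerProductSpace.HarmonicAt h x} :=
    (Metric.closedBall_subset_ball hrε).trans hεK
  have hcirc : ∀ t, circleMap w r t ∈ K := fun t =>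
    (hball (Metric.sphere_subset_closedBall (circleMap_mem_sphere w hr0.le t))).1
  have hav : (2 * Real.pi)⁻¹ * ∫ t in Set.Ioc 0 (2 * Real.pi), h (circleMap w r t) = h w := by
    have : Real.circleAverage h w r = h w := InnerProductSpace.HarmonicOnNhd.circleAverage_eq
      (fun x hx => (hball (by rwa [abs_of_pos hr0] at hx)).2)
    rw [← this, Real.circleAverage_def, smul_eq_mul,
      intervalIntegral.integral_of_le (by positivity)]
  have hcont : Continuous fun t => h (circleMap w r t) :=
    hc.comp_continuous (continuous_circleMap w r) hcirc
  by_contra hne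
  have hw0 : circleMap w r 0 = w + r := by simp [circleMap]
  have hlt : u (circleMap w r 0) - (h (circleMap w r 0) : EReal) < (m : EReal) := by
    have := lt_of_le_of_ne (hle _ (hcirc 0)) (by rw [hw0]; exact hne)
    rw [EReal.coe_add] at this
    exact EReal.sub_lt_of_lt_add this
  obtain ⟨m', hm', hm'm⟩ := EReal.lt_iff_exists_real_btwn.1 hlt
  have husc := (hu.upperSemicontinuousOn.mono hKU).sub_real hc
  have h0 : ∀ᶠ t in 𝓝 (0:ℝ), u (circleMap w r t) - (h (circleMap w r t) : EReal) < m' := by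
    have ht : Tendsto (circleMap w r) (𝓝 0) (𝓝[K] (circleMap w r 0)) :=
      tendsto_nhdsWithin_iff.2 ⟨(continuous_circleMap w r).tendsto 0, Eventually.of_forall hcirc⟩
    exact ht.eventually (husc _ (hcirc 0) _ hm')
  obtain ⟨δ, hδ, hδh⟩ := Metric.eventually_nhds_iff.1 h0
  have hm'm' : m' < m := by exact_mod_cast hm'm
  obtain ⟨η, hη0, hηδ, hηπ⟩ : ∃ η : ℝ, 0 < η ∧ η ≤ δ / 2 ∧ η ≤ 2 * Real.pi :=
    ⟨min (δ / 2) (2 * Real.pi), lt_min (by positivity) (by positivity), min_le_left _ _,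
      min_le_right _ _⟩
  -- An integrable majorant of `u` on the circle, lowered by `m - m'` on an arc starting at angle 0.
  -- The arc is one-sided because the mean is taken over `(0, 2π]`.
  set φ : ℝ → ℝ := fun t => (m + h (circleMap w r t)) -
    (Set.Ioc 0 η).indicator (fun _ => m - m') t with hφ
  have hi1 : IntegrableOn (fun t => m + h (circleMap w r t)) (Set.Ioc 0 (2 * Real.pi)) :=
    ((continuous_const.add hcont).integrableOn_Icc (a := 0) (b := 2 * Real.pi)).mono_set
      Set.Ioc_subset_Icc_self
  have hi0 : IntegrableOn (fun t => h (circleMap w r t)) (Set.Ioc 0 (2 * Real.pi)) :=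
    (hcont.integrableOn_Icc (a := 0) (b := 2 * Real.pi)).mono_set
      Set.Ioc_subset_Icc_self
  have hi2 : IntegrableOn ((Set.Ioc 0 η).indicator (fun _ => m - m')) (Set.Ioc 0 (2 * Real.pi)) :=
    (integrableOn_const measure_Ioc_lt_top.ne).indicator measurableSet_Ioc
  have hle2 := circleMean_le_of_le (u := u) (w := w) (r := r) (φ := φ) (hi1.sub hi2) (by
    intro t ht
    by_cases htη : t ∈ Set.Ioc 0 η
    · have h1 : dist t 0 < δ := by
        rw [Real.dist_eq, sub_zero, abs_of_pos htη.1]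
        have := htη.2.trans hηδ; linarith
      have h2 := hδh h1
      have h3 : u (circleMap w r t) ≤ (m' : EReal) + (h (circleMap w r t) : EReal) := by
        refine (EReal.sub_le_iff_le_add ?_ ?_).1 h2.le <;> simp
      rw [← EReal.coe_add] at h3
      refine h3.trans (by
        simp only [hφ, Set.indicator_of_mem htη]; exact_mod_cast (by linarith))
    · simp only [hφ, Set.indicator_of_notMem htη, sub_zero]
      exact hle _ (hcirc t))
  have hle3 := (hmean r hr0 hrρ).trans hle2
  rw [hw, EReal.coe_le_coe_iff] at hle3
  have hint : ∫ t in Set.Ioc 0 (2 * Real.pi), φ t =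
      2 * Real.pi * m + (∫ t in Set.Ioc 0 (2 * Real.pi), h (circleMap w r t)) - η * (m - m') := by
    have e1 : ∫ t in Set.Ioc 0 (2 * Real.pi), φ t =
      (∫ t in Set.Ioc 0 (2 * Real.pi), (m + h (circleMap w r t))) -
       ∫ t in Set.Ioc 0 (2 * Real.pi), (Set.Ioc 0 η).indicator (fun _ => m - m') t :=
      integral_sub hi1 hi2
    rw [e1, integral_add (integrable_const m) hi0, setIntegral_indicator measurableSet_Ioc,
      Set.inter_eq_right.2 (Set.Ioc_subset_Ioc_right hηπ)]
    simp [Real.pi_pos.le, max_eq_left hη0.le]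
  rw [hint] at hle3
  have : (2 * Real.pi)⁻¹ * (2 * Real.pi * m + (∫ t in Set.Ioc 0 (2 * Real.pi),
      h (circleMap w r t)) - η * (m - m')) = m + h w - (2 * Real.pi)⁻¹ * (η * (m - m')) := by
    rw [← hav]; field_simp
  rw [this] at hle3
  have : 0 < (2 * Real.pi)⁻¹ * (η * (m - m')) := by
    have : 0 < m - m' := by linarith
    positivity
  linarith

/-- The maximum principle, comparing a subharmonic function with a harmonic one. -/
lemma SubharmonicOn.le_of_le_boundary {U : Set ℂ} {u : ℂ → EReal} (hu : SubharmonicOn u U)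
    {K F : Set ℂ} (hK : IsCompact K) (hKU : K ⊆ U) {h : ℂ → ℝ} (hc : ContinuousOn h K)
    (hi : ∀ w ∈ K, w ∉ F → K ∈ 𝓝 w ∧ InnerProductSpace.HarmonicAt h w)
    (hF : ∀ z ∈ K, z ∈ F → u z ≤ h z) : ∀ z ∈ K, u z ≤ h z := by
  by_contra! hcon
  obtain ⟨z₀, hz₀, hlt⟩ := hcon
  have husc := (hu.upperSemicontinuousOn.mono hKU).sub_real hc
  obtain ⟨w₀, hw₀, hmax⟩ := husc.exists_isMaxOn ⟨z₀, hz₀⟩ hK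
  have hpos : ∀ z, (h z : EReal) < u z → 0 < u z - (h z : EReal) := fun z hz => by
    exact EReal.sub_pos.2 hz
  have hm0 : 0 < u w₀ - (h w₀ : EReal) := (hpos _ hlt).trans_le (hmax hz₀)
  obtain ⟨m, hm⟩ : ∃ m : ℝ, u w₀ - (h w₀ : EReal) = m := by
    have ht : u w₀ ≠ ⊤ := (hu.lt_top _ (hKU hw₀)).ne
    have hb : u w₀ ≠ ⊥ := by
      rintro hb; rw [hb] at hm0; simp at hm0
    lift u w₀ to ℝ using ⟨ht, hb⟩ with x
    exact ⟨x - h w₀, by simp⟩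
  have hm0' : 0 < m := by rw [hm] at hm0; exact_mod_cast hm0
  have hle : ∀ z ∈ K, u z ≤ ((m + h z : ℝ) : EReal) := fun z hz => by
    have : u z - (h z : EReal) ≤ m := hm ▸ hmax hz
    rw [EReal.coe_add]
    refine (EReal.sub_le_iff_le_add ?_ ?_).1 this <;> simp
  have hE := husc.isCompact_inter_preimage_Ici hK (m : EReal)
  -- The rightmost point of the compact set where `u - h` is maximal. The maximum propagates to
  -- points further right, a contradiction, so no connectedness argument is needed.
  obtain ⟨w, hw, hwmax⟩ := hE.exists_isMaxOn ⟨w₀, hw₀, hm.ge⟩ Complex.continuous_re.continuousOn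
  have hEeq : ∀ z, u z = ((m + h z : ℝ) : EReal) → (m : EReal) ≤ u z - (h z : EReal) := by
    intro z hz; rw [hz, ← EReal.coe_sub]; simp
  have hwu : u w = ((m + h w : ℝ) : EReal) := by
    refine le_antisymm (hle w hw.1) ?_
    rw [EReal.coe_add]
    have h2 : (m : EReal) ≤ u w - (h w : EReal) := hw.2
    exact (EReal.le_sub_iff_add_le (by simp) (by simp)).1 h2
  have hwF : w ∉ F := fun hf => by
    have := hF w hw.1 hf
    rw [hwu, EReal.coe_le_coe_iff] at this
    linarith
  obtain ⟨hKw, hhw⟩ := hi w hw.1 hwF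
  have hev := hu.not_isMaxOn_of_lt hKU hc hKw hhw hwu hle
  have hev2 : ∀ᶠ r : ℝ in 𝓝[>] 0, w + r ∈ K := by
    have : Tendsto (fun r : ℝ => w + r) (𝓝[>] 0) (𝓝 w) := by
      have : Tendsto (fun r : ℝ => w + r) (𝓝 0) (𝓝 (w + (0:ℝ))) :=
        (by fun_prop : Continuous fun r : ℝ => w + (r:ℂ)).tendsto 0
      simp only [Complex.ofReal_zero, add_zero] at this
      exact this.mono_left nhdsWithin_le_nhds
    exact this.eventually hKw
  obtain ⟨r, ⟨hr1, hr2⟩, hr0⟩ := ((hev.and hev2).and self_mem_nhdsWithin).exists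
  have h4 : (w + r).re ≤ w.re := hwmax ⟨hr2, hEeq _ hr1⟩
  have h5 : (0:ℝ) < r := hr0
  simp at h4
  linarith

/-! ### Super-mean value property on every circle -/

/-- Inf-convolution with the Lipschitz cone `n * edist`. Truncating `g` at `n` first keeps the
approximants finite. -/
lemma LowerSemicontinuous.exists_seq_continuous {X : Type*} [PseudoEMetricSpace X]
    {g : X → ENNReal} (hg : LowerSemicontinuous g) :
    ∃ ψ : ℕ → X → ENNReal, (∀ n, Continuous (ψ n)) ∧ Monotone ψ ∧ (∀ n x, ψ n x ≤ n) ∧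
      ∀ x, ⨆ n, ψ n x = g x := by
  refine ⟨fun n x => ⨅ y, min (g y) n + n * edist x y, fun n => ?_, ?_, ?_, ?_⟩
  · refine continuous_of_le_add_edist n (by simp) fun x y => ?_
    rw [ENNReal.iInf_add]
    refine le_iInf fun z => (iInf_le _ z).trans ?_
    rw [add_assoc, ← mul_add]
    gcongr
    rw [add_comm, edist_comm]
    calc edist z x ≤ edist z y + edist y x := edist_triangle _ _ _
      _ = edist x y + edist y z := by rw [edist_comm z y, edist_comm y x, add_comm]
  · intro m n hmn x
    refine iInf_mono fun y => ?_
    have : (m : ENNReal) ≤ n := by exact_mod_cast hmn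
    gcongr
  · intro n x
    refine (iInf_le _ x).trans ?_
    simp
  · intro x
    refine le_antisymm (iSup_le fun n => (iInf_le _ x).trans (by simp)) ?_
    refine le_of_forall_lt fun c hc => ?_
    obtain ⟨c', hcc', hc'⟩ := exists_between hc
    obtain ⟨δ₀, hδ₀, hδh₀⟩ := EMetric.mem_nhds_iff.1 (hg x c' hc')
    obtain ⟨δ, hδ, hδt, hδh⟩ : ∃ δ : ENNReal, 0 < δ ∧ δ ≠ ⊤ ∧
        Metric.eball x δ ⊆ {y | c' < g y} :=
      ⟨min δ₀ 1, lt_min hδ₀ one_pos, by simp,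
        (Metric.eball_subset_eball (min_le_left _ _)).trans hδh₀⟩
    have hc't : c' ≠ ⊤ := hc'.ne_top
    obtain ⟨n, hn⟩ := ENNReal.exists_nat_gt
      (ENNReal.div_ne_top hc't hδ.ne' : c' / δ ≠ ⊤)
    obtain ⟨n', hn'⟩ := ENNReal.exists_nat_gt hc't
    refine hcc'.trans_le (le_iSup_of_le (max n n') (le_iInf fun y => ?_))
    have h1 : (n : ENNReal) ≤ (max n n' : ℕ) := by exact_mod_cast le_max_left _ _
    have h2 : (n' : ENNReal) ≤ (max n n' : ℕ) := by exact_mod_cast le_max_right _ _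
    by_cases hy : y ∈ Metric.eball x δ
    · exact le_add_right (le_min (hδh hy).le (hn'.le.trans h2))
    · refine le_add_left ?_
      have h3 : δ ≤ edist x y := by
        rw [edist_comm]; simpa using hy
      calc c' = c' / δ * δ := by
            rw [ENNReal.div_mul_cancel hδ.ne' hδt]
        _ ≤ n * edist x y := by gcongr
        _ ≤ _ := by gcongr

/-- Nonnegative frequencies go into `p` and negative ones into the conjugate of `q`. This is the
explicit harmonic extension of a trigonometric polynomial to the disc. -/
lemma exists_harmonic_of_mem_span_fourier {g : C(AddCircle (2 * Real.pi), ℂ)}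
    (hg : g ∈ Submodule.span ℂ (Set.range (fourier (T := 2 * Real.pi)))) :
    ∃ p q : Polynomial ℂ, ∀ t : ℝ, g (t : AddCircle (2 * Real.pi)) =
      p.eval (Complex.exp (t * Complex.I)) +
        (starRingEnd ℂ) (q.eval (Complex.exp (t * Complex.I))) := by
  induction hg using Submodule.span_induction with
  | mem x hx =>
    obtain ⟨n, rfl⟩ := hx
    have key : ∀ t : ℝ, fourier n (t : AddCircle (2 * Real.pi)) =
        Complex.exp (n * (t * Complex.I)) := fun t => by
      rw [fourier_coe_apply]
      congr 1
      have : (Real.pi : ℂ) ≠ 0 := by exact_mod_cast Real.pi_ne_zero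
      push_cast
      field_simp
    obtain ⟨m, rfl | rfl⟩ := n.eq_nat_or_neg
    · refine ⟨Polynomial.X ^ m, 0, fun t => ?_⟩
      rw [key]; simp [← Complex.exp_nat_mul]
    · refine ⟨0, Polynomial.X ^ m, fun t => ?_⟩
      rw [key]; simp [← Complex.exp_nat_mul, ← Complex.exp_conj]
  | zero => exact ⟨0, 0, fun t => by simp⟩
  | add x y _ _ hx hy =>
    obtain ⟨p, q, h⟩ := hx
    obtain ⟨p', q', h'⟩ := hy
    refine ⟨p + p', q + q', fun t => ?_⟩
    simp [h, h']; ring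
  | smul c x _ hx =>
    obtain ⟨p, q, h⟩ := hx
    refine ⟨Polynomial.C c * p, Polynomial.C ((starRingEnd ℂ) c) * q, fun t => ?_⟩
    simp [h]; ring

instance : Fact (0 < 2 * Real.pi) := ⟨by positivity⟩

/-- Passes from the local submean inequality to any closed disc in `U`. The boundary majorant `φ` is
uniformly approximated by trigonometric polynomials, which extend harmonically to the disc, so the
maximum principle replaces the Poisson integral. -/
lemma SubharmonicOn.le_integral_of_le {U : Set ℂ} {u : ℂ → EReal} (hu : SubharmonicOn u U)
    {w : ℂ} {r : ℝ} (hr : 0 < r) (hU : Metric.closedBall w r ⊆ U)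
    (φ : C(AddCircle (2 * Real.pi), ℝ))
    (hφ : ∀ t : ℝ, u (circleMap w r t) ≤ (φ (t : AddCircle (2 * Real.pi)) : EReal)) :
    u w ≤ (((2 * Real.pi)⁻¹ * ∫ t in (0:ℝ)..(2 * Real.pi),
      φ (t : AddCircle (2 * Real.pi)) : ℝ) : EReal) := by
  have hφc : Continuous fun t : ℝ => φ (t : AddCircle (2 * Real.pi)) :=
    φ.continuous.comp (AddCircle.continuous_mk' _)
  set I := (2 * Real.pi)⁻¹ * ∫ t in (0:ℝ)..(2 * Real.pi), φ (t : AddCircle (2 * Real.pi)) with hI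
  suffices H : ∀ ε : ℝ, 0 < ε → u w ≤ ((I + 2 * ε : ℝ) : EReal) by
    refine EReal.le_of_forall_lt_iff_le.1 fun z hz => ?_
    have hz' : I < z := by exact_mod_cast hz
    have := H ((z - I) / 2) (by linarith)
    convert this using 2
    ring
  intro ε hε
  let Φ : C(AddCircle (2 * Real.pi), ℂ) := ⟨fun x => (φ x : ℂ), by fun_prop⟩
  have hΦ : Φ ∈ closure ((Submodule.span ℂ (Set.range (fourier (T := 2 * Real.pi)))) :
      Set C(AddCircle (2 * Real.pi), ℂ)) := by
    rw [← Submodule.topologicalClosure_coe, span_fourier_closure_eq_top]; trivial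
  obtain ⟨g, hg, hgd⟩ := Metric.mem_closure_iff.1 hΦ ε hε
  obtain ⟨p, q, hpq⟩ := exists_harmonic_of_mem_span_fourier hg
  -- Conjugating `q` does not change its real part, so the real part of the extension is that of the
  -- polynomial `p + q`.
  set h : ℂ → ℝ := fun z => ((p + q).eval ((z - w) / r)).re with hh
  have hharm : ∀ z, InnerProductSpace.HarmonicAt h z := fun z => by
    have : AnalyticAt ℂ (fun z => (p + q).eval ((z - w) / r)) z := by
      have : Differentiable ℂ (fun z => (p + q).eval ((z - w) / r)) :=
        (p + q).differentiable.comp (by fun_prop)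
      exact this.analyticAt z
    exact this.harmonicAt_re
  have hcirc : ∀ t : ℝ, h (circleMap w r t) = (g (t : AddCircle (2 * Real.pi))).re := fun t => by
    have hr' : (r : ℂ) ≠ 0 := by exact_mod_cast hr.ne'
    simp only [hh, hpq, circleMap, add_sub_cancel_left, mul_div_cancel_left₀ _ hr',
      Polynomial.eval_add, Complex.add_re, Complex.conj_re]
  have hclose : ∀ t : ℝ, |φ (t : AddCircle (2 * Real.pi)) - h (circleMap w r t)| ≤ ε := fun t => by
    have h1 : dist (Φ (t : AddCircle (2 * Real.pi))) (g t) ≤ ε :=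
      (ContinuousMap.dist_apply_le_dist _).trans hgd.le
    rw [hcirc]
    rw [Complex.dist_eq] at h1
    have h2 := (Complex.abs_re_le_norm (Φ (t : AddCircle (2 * Real.pi)) - g t)).trans h1
    simpa [Φ] using h2
  have hhc : Continuous h := by
    simp only [hh]
    exact Complex.continuous_re.comp ((p + q).continuous.comp (by fun_prop))
  have hmax := hu.le_of_le_boundary (isCompact_closedBall w r) hU (F := Metric.sphere w r)
    (h := fun z => h z + ε) (by fun_prop) (fun z hz hzF => ⟨by
      refine mem_of_superset (Metric.isOpen_ball.mem_nhds (?_ : z ∈ Metric.ball w r))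
        Metric.ball_subset_closedBall
      rw [Metric.mem_ball]
      exact lt_of_le_of_ne hz hzF, (hharm z).add (InnerProductSpace.harmonicAt_const ε)⟩) (by
    intro z _ hz
    obtain ⟨t, rfl⟩ : ∃ t, circleMap w r t = z := by
      rw [← abs_of_pos hr, ← range_circleMap] at hz; exact hz
    refine (hφ t).trans ?_
    have := abs_le.1 (hclose t)
    exact_mod_cast (by linarith)) w (Metric.mem_closedBall_self hr.le)
  refine hmax.trans ?_
  have hav : (2 * Real.pi)⁻¹ * ∫ t in (0:ℝ)..(2 * Real.pi), h (circleMap w r t) = h w := by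
    have : Real.circleAverage h w r = h w := InnerProductSpace.HarmonicOnNhd.circleAverage_eq
      (fun x _ => hharm x)
    rw [← this, Real.circleAverage_def, smul_eq_mul]
  have hle : ∫ t in (0:ℝ)..(2 * Real.pi), h (circleMap w r t) ≤
      ∫ t in (0:ℝ)..(2 * Real.pi), (φ (t : AddCircle (2 * Real.pi)) + ε) := by
    refine intervalIntegral.integral_mono_on (by positivity)
      ((hhc.comp (continuous_circleMap w r)).intervalIntegrable _ _)
      ((hφc.add continuous_const).intervalIntegrable _ _) fun t _ => ?_
    have := abs_le.1 (hclose t)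
    linarith
  rw [intervalIntegral.integral_add (hφc.intervalIntegrable _ _) (by simp)] at hle
  have h3 := mul_le_mul_of_nonneg_left hle (by positivity : (0:ℝ) ≤ (2 * Real.pi)⁻¹)
  rw [hav, mul_add] at h3
  have h4 : (2 * Real.pi)⁻¹ * ∫ _ in (0:ℝ)..(2 * Real.pi), ε = ε := by
    simp; field_simp
  rw [h4] at h3
  exact_mod_cast (by linarith)

lemma UpperSemicontinuousWithinAt.const_sub_toENNReal {X : Type*} [TopologicalSpace X]
    {u : X → EReal} {s : Set X} {x : X} (hu : UpperSemicontinuousWithinAt u s x) (C : ℝ) :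
    LowerSemicontinuousWithinAt (fun y => ((C : EReal) - u y).toENNReal) s x := by
  intro c hc
  have hct : c ≠ ⊤ := hc.ne_top
  have h1 : u x < ((C - c.toReal : ℝ) : EReal) := by
    by_contra! hcon
    have h2 : (C : EReal) - u x ≤ (c.toReal : EReal) := by
      refine (EReal.sub_le_sub le_rfl hcon).trans ?_
      rw [← EReal.coe_sub]; simp
    have h3 := EReal.toENNReal_le_toENNReal h2
    rw [EReal.real_coe_toENNReal, ENNReal.ofReal_toReal hct] at h3
    exact absurd hc (not_lt.2 h3)
  filter_upwards [hu _ h1] with y hy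
  have h5 : (c.toReal : EReal) < (C : EReal) - u y := by
    by_contra! hcon
    have : (C : EReal) - c.toReal ≤ u y := by
      rw [EReal.sub_le_iff_le_add (by simp) (by simp)] at hcon ⊢
      rwa [add_comm]
    rw [EReal.coe_sub] at hy
    exact absurd hy (not_lt.2 this)
  have h6 := EReal.toENNReal_lt_toENNReal (by exact_mod_cast ENNReal.toReal_nonneg) h5
  rwa [EReal.real_coe_toENNReal, ENNReal.ofReal_toReal hct] at h6

/-- Super-mean value property of `C - u` on circles. -/
lemma SubharmonicOn.lintegral_circle_le {U : Set ℂ} {u : ℂ → EReal} (hu : SubharmonicOn u U)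
    {w : ℂ} {r : ℝ} (hr : 0 < r) (hU : Metric.closedBall w r ⊆ U) {C : ℝ}
    (hC : ∀ z ∈ Metric.closedBall w r, u z ≤ C) :
    ∫⁻ t in Set.Ioc 0 (2 * Real.pi), ((C : EReal) - u (circleMap w r t)).toENNReal ≤
      ENNReal.ofReal (2 * Real.pi) * ((C : EReal) - u w).toENNReal := by
  let e : AddCircle (2 * Real.pi) → ℂ := fun x => w + r * AddCircle.toCircle x
  have he : Continuous e := by
    have : Continuous fun x : AddCircle (2 * Real.pi) => ((AddCircle.toCircle x : Circle) : ℂ) :=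
      continuous_subtype_val.comp AddCircle.continuous_toCircle
    fun_prop
  have hemem : ∀ x, e x ∈ Metric.sphere w r := fun x => by
    have : ‖((AddCircle.toCircle x : Circle) : ℂ)‖ = 1 := Circle.norm_coe _
    simp [e, abs_of_pos hr, this]
  have het : ∀ t : ℝ, e t = circleMap w r t := fun t => by
    simp only [e, AddCircle.toCircle_apply_mk, circleMap, Circle.coe_exp]
    rw [div_self (by positivity), one_mul]
  let g : AddCircle (2 * Real.pi) → ENNReal := fun x => ((C : EReal) - u (e x)).toENNReal
  have hg : LowerSemicontinuous g := by
    intro x c hc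
    have h1 := UpperSemicontinuousWithinAt.const_sub_toENNReal (hu.upperSemicontinuousOn.mono hU
      (e x) (Metric.sphere_subset_closedBall (hemem x))) C c hc
    have ht : Tendsto e (𝓝 x) (𝓝[Metric.closedBall w r] (e x)) :=
      tendsto_nhdsWithin_iff.2 ⟨he.tendsto x,
        Eventually.of_forall fun y => Metric.sphere_subset_closedBall (hemem y)⟩
    exact ht.eventually h1
  obtain ⟨ψ, hψc, hψm, hψn, hψs⟩ := hg.exists_seq_continuous
  have hψt : ∀ n x, ψ n x ≠ ⊤ := fun n x => ((hψn n x).trans_lt (by simp)).ne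
  have hbd : ∀ n, ∫⁻ t in Set.Ioc 0 (2 * Real.pi), ψ n (t : ℝ) ≤
      ENNReal.ofReal (2 * Real.pi) * ((C : EReal) - u w).toENNReal := by
    intro n
    have hψr : Continuous fun x => (ψ n x).toReal :=
      ENNReal.continuousOn_toReal.comp_continuous (hψc n) (hψt n)
    have hcr : Continuous fun t : ℝ => (ψ n (t : AddCircle (2 * Real.pi))).toReal :=
      hψr.comp (AddCircle.continuous_mk' _)
    let φ : C(AddCircle (2 * Real.pi), ℝ) := ⟨fun x => C - (ψ n x).toReal, by fun_prop⟩
    have h1 := hu.le_integral_of_le hr hU φ (by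
      intro t
      have h2 : ψ n t ≤ g t := hψs t ▸ le_iSup (fun n => ψ n (t : AddCircle (2 * Real.pi))) n
      have h3 : (ψ n t : EReal) ≤ (C : EReal) - u (circleMap w r t) := by
        have h4 : (g t : EReal) = (C : EReal) - u (circleMap w r t) := by
          rw [← het]
          exact EReal.coe_toENNReal (EReal.sub_nonneg (by simp) (by simp) |>.2
            (hC _ (Metric.sphere_subset_closedBall (hemem t))))
        rw [← h4]; exact_mod_cast h2
      rw [← EReal.coe_ennreal_toReal (hψt n t)] at h3
      have h5 := (EReal.le_sub_iff_add_le (by simp) (by simp)).1 h3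
      change _ ≤ ((C - (ψ n t).toReal : ℝ) : EReal)
      rw [EReal.coe_sub]
      refine (EReal.le_sub_iff_add_le (by simp) (by simp)).2 ?_
      rwa [add_comm])
    have h6 : (2 * Real.pi)⁻¹ * ∫ t in (0:ℝ)..(2 * Real.pi), φ (t : AddCircle (2 * Real.pi)) =
        C - (2 * Real.pi)⁻¹ * ∫ t in Set.Ioc 0 (2 * Real.pi),
          (ψ n (t : AddCircle (2 * Real.pi))).toReal := by
      have : ∫ t in (0:ℝ)..(2 * Real.pi), φ (t : AddCircle (2 * Real.pi)) =
        ∫ t in (0:ℝ)..(2 * Real.pi), (C - (ψ n (t : AddCircle (2 * Real.pi))).toReal) := rfl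
      rw [this, intervalIntegral.integral_sub (by simp) (hcr.intervalIntegrable _ _),
        intervalIntegral.integral_const,
        intervalIntegral.integral_of_le (by positivity : (0:ℝ) ≤ 2 * Real.pi), smul_eq_mul]
      field_simp
      ring
    rw [h6] at h1
    set J := ∫ t in Set.Ioc 0 (2 * Real.pi), (ψ n (t : AddCircle (2 * Real.pi))).toReal with hJ
    have h7 : ∫⁻ t in Set.Ioc 0 (2 * Real.pi), ψ n (t : ℝ) = ENNReal.ofReal J := by
      rw [hJ, ofReal_integral_eq_lintegral_ofReal
        ((hcr.integrableOn_Icc (a := 0) (b := 2 * Real.pi)).mono_set Set.Ioc_subset_Icc_self)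
        (ae_of_all _ fun t => ENNReal.toReal_nonneg)]
      simp_rw [ENNReal.ofReal_toReal (hψt n _)]
    have h8 : (((2 * Real.pi)⁻¹ * J : ℝ) : EReal) ≤ (C : EReal) - u w := by
      rw [EReal.coe_sub] at h1
      have h9 := (EReal.le_sub_iff_add_le (by simp) (by simp)).1 h1
      refine (EReal.le_sub_iff_add_le (by simp) (by simp)).2 ?_
      rwa [add_comm]
    have h10 := EReal.toENNReal_le_toENNReal h8
    rw [EReal.real_coe_toENNReal] at h10
    rw [h7]
    calc ENNReal.ofReal J
        = ENNReal.ofReal (2 * Real.pi) * ENNReal.ofReal ((2 * Real.pi)⁻¹ * J) := by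
          rw [← ENNReal.ofReal_mul (by positivity)]; congr 1; field_simp
      _ ≤ _ := by gcongr
  calc ∫⁻ t in Set.Ioc 0 (2 * Real.pi), ((C : EReal) - u (circleMap w r t)).toENNReal
      = ∫⁻ t in Set.Ioc 0 (2 * Real.pi), ⨆ n, ψ n (t : ℝ) := by
        simp_rw [hψs, g, het]
    _ = ⨆ n, ∫⁻ t in Set.Ioc 0 (2 * Real.pi), ψ n (t : ℝ) := by
        refine lintegral_iSup (fun n => ?_) fun m n hmn t => hψm hmn _
        exact ((hψc n).comp (AddCircle.continuous_mk' _)).measurable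
    _ ≤ _ := iSup_le hbd

/-! ### Polar coordinates and disc averages -/

lemma lintegral_ball_eq_polar {f : ℂ → ENNReal} (hf : Measurable f) (w : ℂ) (R : ℝ) :
    ∫⁻ y in Metric.ball w R, f y = ∫⁻ s in Set.Ioo 0 R, ENNReal.ofReal s *
      ∫⁻ t in Set.Ioc 0 (2 * Real.pi), f (circleMap w s t) := by
  set g : ℂ → ENNReal := (Metric.ball w R).indicator f with hg
  have hgm : Measurable g := hf.indicator measurableSet_ball
  have h1 : ∫⁻ y in Metric.ball w R, f y = ∫⁻ z, g (w - z) := by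
    rw [← lintegral_indicator measurableSet_ball]
    exact (lintegral_sub_left_eq_self g w).symm
  have h2 : ∀ s : ℝ, ∫⁻ t in Set.Ioo (-Real.pi) Real.pi,
      g (w - Complex.polarCoord.symm (s, t)) =
      ∫⁻ t in Set.Ioc 0 (2 * Real.pi), g (circleMap w s t) := fun s => by
    rw [← setLIntegral_congr (Ioo_ae_eq_Ioc (a := (0:ℝ)) (b := 2 * Real.pi))]
    rw [← lintegral_indicator measurableSet_Ioo, ← lintegral_indicator measurableSet_Ioo,
      ← lintegral_sub_right_eq_self _ Real.pi]
    congr 1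
    ext t
    have h3 : t - Real.pi ∈ Set.Ioo (-Real.pi) Real.pi ↔ t ∈ Set.Ioo 0 (2 * Real.pi) := by
      simp only [Set.mem_Ioo]
      constructor <;> rintro ⟨h, h'⟩ <;> constructor <;> linarith
    by_cases ht : t ∈ Set.Ioo 0 (2 * Real.pi)
    · rw [Set.indicator_of_mem ht, Set.indicator_of_mem (h3.2 ht)]
      congr 1
      simp only [Complex.polarCoord_symm_apply, circleMap, Real.cos_sub_pi, Real.sin_sub_pi,
        Complex.exp_mul_I]
      push_cast
      ring
    · rw [Set.indicator_of_notMem ht, Set.indicator_of_notMem (mt h3.1 ht)]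
  rw [h1, ← Complex.lintegral_comp_polarCoord_symm, polarCoord_target, Measure.volume_eq_prod,
    setLIntegral_prod]
  · have h4 : ∀ s ∈ Set.Ioi (0:ℝ), (∫⁻ t in Set.Ioo (-Real.pi) Real.pi,
        ENNReal.ofReal (s, t).1 • g (w - Complex.polarCoord.symm (s, t))) =
        (Set.Ioo 0 R).indicator (fun s => ENNReal.ofReal s *
          ∫⁻ t in Set.Ioc 0 (2 * Real.pi), f (circleMap w s t)) s := by
      intro s hs
      simp only [smul_eq_mul]
      rw [lintegral_const_mul' _ _ ENNReal.ofReal_ne_top, h2]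
      have hd : ∀ t, dist (circleMap w s t) w = s := fun t => by
        simp [dist_eq_norm, abs_of_pos (Set.mem_Ioi.1 hs)]
      by_cases hsR : s < R
      · rw [Set.indicator_of_mem (Set.mem_Ioo.2 ⟨Set.mem_Ioi.1 hs, hsR⟩)]
        congr 2; ext t
        rw [hg, Set.indicator_of_mem]
        rw [Metric.mem_ball, hd]; exact hsR
      · rw [Set.indicator_of_notMem (fun h => hsR h.2)]
        have : ∀ t, g (circleMap w s t) = 0 := fun t => by
          rw [hg, Set.indicator_of_notMem]
          rw [Metric.mem_ball, hd]; exact hsR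
        simp [this]
    rw [setLIntegral_congr_fun measurableSet_Ioi h4, lintegral_indicator measurableSet_Ioo,
      Measure.restrict_restrict measurableSet_Ioo, Set.inter_eq_left.2 Set.Ioo_subset_Ioi_self]
  · refine (Measurable.smul (f := fun p : ℝ × ℝ => ENNReal.ofReal p.1) (by fun_prop)
      (hgm.comp ?_)).aemeasurable
    simp only [Complex.polarCoord_symm_apply]
    fun_prop

lemma lintegral_Ioo_ofReal {R : ℝ} (hR : 0 ≤ R) {g : ℝ → ℝ} (hg : Continuous g)
    (h0 : ∀ s ∈ Set.Ioo 0 R, 0 ≤ g s) :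
    ∫⁻ s in Set.Ioo 0 R, ENNReal.ofReal (g s) = ENNReal.ofReal (∫ s in (0:ℝ)..R, g s) := by
  rw [intervalIntegral.integral_of_le hR, integral_Ioc_eq_integral_Ioo,
    ofReal_integral_eq_lintegral_ofReal]
  · exact (hg.integrableOn_Icc (a := 0) (b := R)).mono_set Set.Ioo_subset_Icc_self
  · exact (ae_restrict_iff' measurableSet_Ioo).2 (ae_of_all _ h0)

lemma lintegral_ball_le_of_circle {f : ℂ → ENNReal} (hf : Measurable f) {w : ℂ} {R : ℝ}
    (hR : 0 ≤ R) {c : ENNReal} (h : ∀ s ∈ Set.Ioo 0 R,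
      ∫⁻ t in Set.Ioc 0 (2 * Real.pi), f (circleMap w s t) ≤ ENNReal.ofReal (2 * Real.pi) * c) :
    ∫⁻ y in Metric.ball w R, f y ≤ ENNReal.ofReal (Real.pi * R ^ 2) * c := by
  rw [lintegral_ball_eq_polar hf]
  calc _ ≤ ∫⁻ s in Set.Ioo 0 R, ENNReal.ofReal (2 * Real.pi * s) * c := by
        refine setLIntegral_mono' measurableSet_Ioo fun s hs => ?_
        rw [mul_comm (2 * Real.pi), ENNReal.ofReal_mul hs.1.le, mul_assoc]
        gcongr
        exact h s hs
    _ = _ := by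
        rw [lintegral_mul_const _ (by fun_prop), lintegral_Ioo_ofReal hR (by fun_prop)
          fun s hs => by have := hs.1; positivity]
        congr 2
        rw [intervalIntegral.integral_const_mul, integral_id]; ring

lemma le_lintegral_ball_of_circle {f : ℂ → ENNReal} (hf : Measurable f) {w : ℂ} {R : ℝ}
    (hR : 0 ≤ R) {c : ENNReal} (h : ∀ s ∈ Set.Ioo 0 R, ENNReal.ofReal (2 * Real.pi) * c ≤
      ∫⁻ t in Set.Ioc 0 (2 * Real.pi), f (circleMap w s t)) :
    ENNReal.ofReal (Real.pi * R ^ 2) * c ≤ ∫⁻ y in Metric.ball w R, f y := by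
  rw [lintegral_ball_eq_polar hf]
  calc _ = ∫⁻ s in Set.Ioo 0 R, ENNReal.ofReal (2 * Real.pi * s) * c := by
        rw [lintegral_mul_const _ (by fun_prop), lintegral_Ioo_ofReal hR (by fun_prop)
          fun s hs => by have := hs.1; positivity]
        congr 2
        rw [intervalIntegral.integral_const_mul, integral_id]; ring
    _ ≤ _ := by
        refine setLIntegral_mono' measurableSet_Ioo fun s hs => ?_
        rw [mul_comm (2 * Real.pi), ENNReal.ofReal_mul hs.1.le, mul_assoc]
        gcongr
        exact h s hs

/-- The average of a nonnegative function over the disc of radius `R` about `w`. -/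
noncomputable def discAvg (R : ℝ) (f : ℂ → ENNReal) (w : ℂ) : ENNReal :=
  (ENNReal.ofReal (Real.pi * R ^ 2))⁻¹ * ∫⁻ y in Metric.ball w R, f y

lemma lintegral_ball_translate (f : ℂ → ENNReal) (w : ℂ) (R : ℝ) :
    ∫⁻ y in Metric.ball w R, f y = ∫⁻ z in Metric.ball 0 R, f (w + z) := by
  rw [← lintegral_indicator measurableSet_ball, ← lintegral_indicator measurableSet_ball,
    ← lintegral_add_left_eq_self _ w]
  congr 1
  ext z
  simp only [Set.indicator, Metric.mem_ball, dist_eq_norm, add_sub_cancel_left, sub_zero]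

lemma measurable_discAvg {R : ℝ} {f : ℂ → ENNReal} (hf : Measurable f) :
    Measurable (discAvg R f) := by
  unfold discAvg
  simp_rw [lintegral_ball_translate f]
  refine Measurable.const_mul ?_ _
  exact Measurable.lintegral_prod_right' (f := fun p : ℂ × ℂ => f (p.1 + p.2)) (by fun_prop)

lemma discAvg_comm {f : ℂ → ENNReal} (hf : Measurable f) (R ρ : ℝ) (w : ℂ) :
    discAvg R (discAvg ρ f) w = discAvg ρ (discAvg R f) w := by
  have key : ∀ R ρ : ℝ, discAvg R (discAvg ρ f) w =
      (ENNReal.ofReal (Real.pi * R ^ 2))⁻¹ * ((ENNReal.ofReal (Real.pi * ρ ^ 2))⁻¹ *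
        ∫⁻ x in Metric.ball 0 R, ∫⁻ y in Metric.ball 0 ρ, f (w + x + y)) := fun R ρ => by
    unfold discAvg
    rw [lintegral_ball_translate]
    simp_rw [lintegral_ball_translate f]
    rw [lintegral_const_mul]
    exact Measurable.lintegral_prod_right' (f := fun p : ℂ × ℂ => f (w + p.1 + p.2)) (by fun_prop)
  rw [key, key, lintegral_lintegral_swap (by fun_prop), mul_left_comm]
  simp_rw [add_right_comm w]

lemma discAvg_add {R : ℝ} {f g : ℂ → ENNReal} (hf : Measurable f) (w : ℂ) :
    discAvg R (fun y => f y + g y) w = discAvg R f w + discAvg R g w := by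
  unfold discAvg
  rw [lintegral_add_left hf, mul_add]

/-- The origin is excluded because the convention `Real.log 0 = 0` gives the logarithmic kernels a
wrong finite value there. One point is negligible for averages. -/
lemma discAvg_congr_ae {R : ℝ} {f g : ℂ → ENNReal} {w : ℂ}
    (h : ∀ y ∈ Metric.ball w R, y ≠ 0 → f y = g y) : discAvg R f w = discAvg R g w := by
  unfold discAvg
  congr 1
  refine setLIntegral_congr_fun_ae measurableSet_ball ?_
  filter_upwards [compl_mem_ae_iff.2 (measure_singleton (0:ℂ))] with y hy hb using h y hb hy

lemma discAvg_le_lintegral (R : ℝ) (f : ℂ → ENNReal) (w : ℂ) :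
    discAvg R f w ≤ (ENNReal.ofReal (Real.pi * R ^ 2))⁻¹ * ∫⁻ y, f y := by
  unfold discAvg
  gcongr 1
  exact setLIntegral_le_lintegral _ _

/-- Disc averages are self-adjoint with respect to convolution. -/
lemma lintegral_mul_discAvg_comm {f g : ℂ → ENNReal} (hf : Measurable f) (hg : Measurable g)
    (R : ℝ) (z : ℂ) :
    ∫⁻ w, f w * discAvg R g (z - w) = ∫⁻ w, g (z - w) * discAvg R f w := by
  unfold discAvg
  simp_rw [lintegral_ball_translate g, lintegral_ball_translate f, mul_left_comm (f _),
    mul_left_comm (g _)]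
  rw [lintegral_const_mul, lintegral_const_mul]
  · congr 1
    calc ∫⁻ w, f w * ∫⁻ y in Metric.ball 0 R, g (z - w + y)
        = ∫⁻ w, ∫⁻ y in Metric.ball 0 R, f w * g (z - w + y) := by
          refine lintegral_congr fun w => (lintegral_const_mul _ (by fun_prop)).symm
      _ = ∫⁻ y in Metric.ball 0 R, ∫⁻ w, f w * g (z - w + y) :=
          lintegral_lintegral_swap (by fun_prop)
      _ = ∫⁻ y in Metric.ball 0 R, ∫⁻ w, g (z - w) * f (w + y) := by
          refine lintegral_congr fun y => ?_
          rw [← lintegral_add_right_eq_self _ y]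
          refine lintegral_congr fun w => ?_
          rw [mul_comm]; congr 2; ring
      _ = ∫⁻ w, ∫⁻ y in Metric.ball 0 R, g (z - w) * f (w + y) :=
          (lintegral_lintegral_swap (by fun_prop)).symm
      _ = _ := lintegral_congr fun w => lintegral_const_mul _ (by fun_prop)
  · refine Measurable.mul (by fun_prop) ?_
    exact Measurable.lintegral_prod_right' (f := fun p : ℂ × ℂ => f (p.1 + p.2)) (by fun_prop)
  · refine Measurable.mul (by fun_prop) ?_
    exact Measurable.lintegral_prod_right' (f := fun p : ℂ × ℂ => g (z - p.1 + p.2)) (by fun_prop)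

lemma discAvg_le_of_circle {f : ℂ → ENNReal} (hf : Measurable f) {w : ℂ} {R : ℝ} (hR : 0 < R)
    {c : ENNReal} (h : ∀ s ∈ Set.Ioo 0 R,
      ∫⁻ t in Set.Ioc 0 (2 * Real.pi), f (circleMap w s t) ≤ ENNReal.ofReal (2 * Real.pi) * c) :
    discAvg R f w ≤ c := by
  have h0 : ENNReal.ofReal (Real.pi * R ^ 2) ≠ 0 := by
    have : 0 < Real.pi * R ^ 2 := by positivity
    simpa using this
  calc discAvg R f w ≤ (ENNReal.ofReal (Real.pi * R ^ 2))⁻¹ *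
        (ENNReal.ofReal (Real.pi * R ^ 2) * c) := by
        unfold discAvg; gcongr; exact lintegral_ball_le_of_circle hf hR.le h
    _ = c := by rw [← mul_assoc, ENNReal.inv_mul_cancel h0 ENNReal.ofReal_ne_top, one_mul]

lemma le_discAvg_of_circle {f : ℂ → ENNReal} (hf : Measurable f) {w : ℂ} {R : ℝ} (hR : 0 < R)
    {c : ENNReal} (h : ∀ s ∈ Set.Ioo 0 R, ENNReal.ofReal (2 * Real.pi) * c ≤
      ∫⁻ t in Set.Ioc 0 (2 * Real.pi), f (circleMap w s t)) :
    c ≤ discAvg R f w := by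
  have h0 : ENNReal.ofReal (Real.pi * R ^ 2) ≠ 0 := by
    have : 0 < Real.pi * R ^ 2 := by positivity
    simpa using this
  calc c = (ENNReal.ofReal (Real.pi * R ^ 2))⁻¹ * (ENNReal.ofReal (Real.pi * R ^ 2) * c) := by
        rw [← mul_assoc, ENNReal.inv_mul_cancel h0 ENNReal.ofReal_ne_top, one_mul]
    _ ≤ _ := by unfold discAvg; gcongr; exact le_lintegral_ball_of_circle hf hR.le h

/-! ### Logarithmic kernels -/

/-- The positive truncated logarithm `log⁺ (T / |y|)`. -/
noncomputable def logPot (T : ℝ) (y : ℂ) : ENNReal := ENNReal.ofReal (Real.log T - Real.log ‖y‖)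

lemma measurable_logPot (T : ℝ) : Measurable (logPot T) := by
  unfold logPot
  exact (measurable_const.sub (Real.measurable_log.comp measurable_norm)).ennreal_ofReal

/-- The mean of `log |y|` over the circle is `max (log s) (log |w|)`. The bound `‖w‖ + s ≤ T` keeps
the truncation at zero inactive, and `1 ≤ T` covers a circle through the origin. -/
lemma lintegral_logPot_circle {T s : ℝ} {w : ℂ} (hT1 : 1 ≤ T) (hs : 0 < s) (hw : w ≠ 0)
    (hT : ‖w‖ + s ≤ T) :
    ∫⁻ t in Set.Ioc 0 (2 * Real.pi), logPot T (circleMap w s t) =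
      ENNReal.ofReal (2 * Real.pi) *
        ENNReal.ofReal (Real.log T - max (Real.log s) (Real.log ‖w‖)) := by
  have hw' : 0 < ‖w‖ := norm_pos_iff.2 hw
  have hint : CircleIntegrable (fun y : ℂ => Real.log ‖y - 0‖) w s :=
    MeromorphicOn.circleIntegrable_log_norm (fun _ _ ↦ by fun_prop)
  simp only [sub_zero] at hint
  have hint' : IntegrableOn (fun t => Real.log ‖circleMap w s t‖) (Set.Ioc 0 (2 * Real.pi)) :=
    (intervalIntegrable_iff_integrableOn_Ioc_of_le (by positivity)).1 hint
  have hav : (2 * Real.pi)⁻¹ * ∫ t in Set.Ioc 0 (2 * Real.pi), Real.log ‖circleMap w s t‖ =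
      max (Real.log s) (Real.log ‖w‖) := by
    have h1 := circleAverage_log_norm_sub_const_eq_log_radius_add_posLog (a := 0) (c := w) hs.ne'
    simp only [sub_zero] at h1
    rw [Real.circleAverage_def, smul_eq_mul, intervalIntegral.integral_of_le (by positivity)] at h1
    rw [h1, show (s⁻¹ * ‖w‖).posLog = max 0 (Real.log (s⁻¹ * ‖w‖)) from rfl,
      Real.log_mul (by positivity) hw'.ne', Real.log_inv,
      ← max_add_add_left]
    simp
  unfold logPot
  rw [← ofReal_integral_eq_lintegral_ofReal, ← ENNReal.ofReal_mul (by positivity),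
    integral_sub (integrable_const _) hint', ← hav]
  · congr 1
    simp [Real.pi_pos.le]
    field_simp
  · exact (integrable_const _).sub hint'
  · refine ae_of_all _ fun t => ?_
    simp only [Pi.zero_apply, sub_nonneg]
    have h2 : ‖circleMap w s t‖ ≤ T := by
      refine le_trans ?_ hT
      have : ‖circleMap w s t‖ ≤ ‖w‖ + ‖circleMap 0 s t‖ := by
        simpa [circleMap] using norm_add_le w (s * Complex.exp (t * Complex.I))
      simpa [abs_of_pos hs] using this
    rcases (norm_nonneg (circleMap w s t)).eq_or_lt with h0 | h0
    · rw [← h0, Real.log_zero]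
      exact Real.log_nonneg hT1
    · exact Real.log_le_log h0 h2

section logPot
variable {T R : ℝ} {w : ℂ}

lemma discAvg_logPot_le (hT1 : 1 ≤ T) (hR : 0 < R) (hw : w ≠ 0) (hT : ‖w‖ + R ≤ T) :
    discAvg R (logPot T) w ≤ logPot T w := by
  refine discAvg_le_of_circle (measurable_logPot T) hR fun s hs => ?_
  rw [lintegral_logPot_circle hT1 hs.1 hw (by linarith [hs.2])]
  unfold logPot
  gcongr
  exact le_max_right _ _

lemma discAvg_logPot_eq (hT1 : 1 ≤ T) (hR : 0 < R) (hw : R ≤ ‖w‖) (hT : ‖w‖ + R ≤ T) :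
    discAvg R (logPot T) w = logPot T w := by
  have hw0 : w ≠ 0 := norm_pos_iff.1 (hR.trans_le hw)
  refine le_antisymm (discAvg_logPot_le hT1 hR hw0 hT) ?_
  refine le_discAvg_of_circle (measurable_logPot T) hR fun s hs => ?_
  rw [lintegral_logPot_circle hT1 hs.1 hw0 (by linarith [hs.2])]
  unfold logPot
  gcongr
  exact max_le (Real.log_le_log hs.1 (hs.2.le.trans hw)) le_rfl

lemma le_discAvg_logPot (hT1 : 1 ≤ T) (hR : 0 < R) (hw0 : w ≠ 0) (hw : ‖w‖ ≤ R)
    (hT : ‖w‖ + R ≤ T) :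
    ENNReal.ofReal (Real.log T - Real.log R) ≤ discAvg R (logPot T) w := by
  refine le_discAvg_of_circle (measurable_logPot T) hR fun s hs => ?_
  rw [lintegral_logPot_circle hT1 hs.1 hw0 (by linarith [hs.2])]
  gcongr
  exact max_le (Real.log_le_log hs.1 hs.2.le) (Real.log_le_log (norm_pos_iff.2 hw0) hw)

/-- Follows from `log (R / s) ≤ R / s - 1`, integrated against `2s / R²`. This yields the constant
`1`; the sharp value `1/2` is not needed. -/
lemma discAvg_logPot_le_add_one (hT1 : 1 ≤ T) (hR : 0 < R) (hw0 : w ≠ 0) (hT : ‖w‖ + R ≤ T) :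
    discAvg R (logPot T) w ≤ ENNReal.ofReal (Real.log T - Real.log R + 1) := by
  have hRT : R ≤ T := by linarith [norm_nonneg w]
  have hlog : Real.log R ≤ Real.log T := Real.log_le_log hR hRT
  unfold discAvg
  rw [lintegral_ball_eq_polar (measurable_logPot T)]
  have h1 : ∀ s ∈ Set.Ioo 0 R, ENNReal.ofReal s *
      ∫⁻ t in Set.Ioc 0 (2 * Real.pi), logPot T (circleMap w s t) ≤
      ENNReal.ofReal (2 * Real.pi * (s * (Real.log T - Real.log R - 1) + R)) := by
    intro s hs
    have hs0 := hs.1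
    have h2 : Real.log (R / s) ≤ R / s - 1 := Real.log_le_sub_one_of_pos (by positivity)
    rw [Real.log_div hR.ne' hs0.ne'] at h2
    rw [lintegral_logPot_circle hT1 hs.1 hw0 (by linarith [hs.2]),
      ← ENNReal.ofReal_mul (by positivity), ← ENNReal.ofReal_mul hs0.le]
    refine ENNReal.ofReal_le_ofReal ?_
    have h3 : Real.log T - max (Real.log s) (Real.log ‖w‖) ≤
        Real.log T - Real.log R + R / s - 1 := by
      have := le_max_left (Real.log s) (Real.log ‖w‖); linarith
    have h4 : s * (Real.log T - max (Real.log s) (Real.log ‖w‖)) ≤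
        s * (Real.log T - Real.log R - 1) + R := by
      calc _ ≤ s * (Real.log T - Real.log R + R / s - 1) := by gcongr
        _ = _ := by field_simp; ring
    calc _ = 2 * Real.pi * (s * (Real.log T - max (Real.log s) (Real.log ‖w‖))) := by ring
      _ ≤ _ := by gcongr
  have h5 := setLIntegral_mono' measurableSet_Ioo h1 (μ := volume)
  rw [lintegral_Ioo_ofReal hR.le (by fun_prop) (fun s hs => by
    have := hs.1
    have : s * 1 < R := by linarith [hs.2]
    have : 0 ≤ s * (Real.log T - Real.log R) := mul_nonneg hs.1.le (by linarith)
    have : 0 ≤ s * (Real.log T - Real.log R - 1) + R := by linarith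
    positivity)] at h5
  have h6 : ∫ s in (0:ℝ)..R, 2 * Real.pi * (s * (Real.log T - Real.log R - 1) + R) =
      Real.pi * R ^ 2 * (Real.log T - Real.log R + 1) := by
    rw [intervalIntegral.integral_const_mul, intervalIntegral.integral_add
      (by apply Continuous.intervalIntegrable; fun_prop) (by simp),
      intervalIntegral.integral_mul_const, integral_id, intervalIntegral.integral_const,
      smul_eq_mul]
    ring
  rw [h6, ENNReal.ofReal_mul (by positivity)] at h5
  have h0 : ENNReal.ofReal (Real.pi * R ^ 2) ≠ 0 := by
    have : 0 < Real.pi * R ^ 2 := by positivity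
    simpa using this
  calc _ ≤ (ENNReal.ofReal (Real.pi * R ^ 2))⁻¹ * (ENNReal.ofReal (Real.pi * R ^ 2) *
        ENNReal.ofReal (Real.log T - Real.log R + 1)) := by gcongr
    _ = _ := by rw [← mul_assoc, ENNReal.inv_mul_cancel h0 ENNReal.ofReal_ne_top, one_mul]

end logPot

/-- The difference between the logarithmic potential of a point mass and that of the uniform
distribution on the disc of radius `R`. The parameter `T` is a normalization, irrelevant as soon
as it is large. -/
noncomputable def discKernel (T R : ℝ) : ℂ → ENNReal :=
  (Metric.ball 0 R).indicator fun y => logPot T y - discAvg R (logPot T) y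

lemma measurable_discKernel (T R : ℝ) : Measurable (discKernel T R) :=
  ((measurable_logPot T).sub (measurable_discAvg (measurable_logPot T))).indicator
    measurableSet_ball

section discKernel
variable {T R ρ : ℝ} {y : ℂ}

lemma discKernel_of_le (h : R ≤ ‖y‖) : discKernel T R y = 0 := by
  unfold discKernel
  rw [Set.indicator_of_notMem]
  simpa using h

/-- Outside the disc, harmonicity of the logarithm makes the two potentials equal, so cutting the
kernel off loses nothing. Inside, superharmonicity makes the truncated subtraction exact. -/
lemma discKernel_add_discAvg (hT1 : 1 ≤ T) (hR : 0 < R) (hy : y ≠ 0) (hT : ‖y‖ + R ≤ T) :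
    discKernel T R y + discAvg R (logPot T) y = logPot T y := by
  by_cases h : R ≤ ‖y‖
  · rw [discKernel_of_le h, zero_add, discAvg_logPot_eq hT1 hR h hT]
  · unfold discKernel
    rw [Set.indicator_of_mem (by simpa using h)]
    exact tsub_add_cancel_of_le (discAvg_logPot_le hT1 hR hy hT)

lemma discKernel_le (hT1 : 1 ≤ T) (hT : 2 * R ≤ T) (hy : y ≠ 0) (hyR : ‖y‖ ≤ R) :
    discKernel T R y ≤ ENNReal.ofReal (Real.log R - Real.log ‖y‖) := by
  have hy0 : 0 < ‖y‖ := norm_pos_iff.2 hy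
  have hR : 0 < R := hy0.trans_le hyR
  refine (Set.indicator_le_self _ _ _).trans ?_
  rw [tsub_le_iff_right]
  refine le_trans ?_ (add_le_add_right (le_discAvg_logPot hT1 hR hy hyR (by linarith)) _)
  rw [← ENNReal.ofReal_add (sub_nonneg.2 (Real.log_le_log hy0 hyR))
    (sub_nonneg.2 (Real.log_le_log hR (by linarith)))]
  unfold logPot
  refine ENNReal.ofReal_le_ofReal (by linarith)

lemma le_discKernel (hT1 : 1 ≤ T) (hT : 2 * R ≤ T) (hy : y ≠ 0) (hyR : ‖y‖ < R) :
    ENNReal.ofReal (Real.log R - Real.log ‖y‖ - 1) ≤ discKernel T R y := by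
  have hR : 0 < R := (norm_nonneg y).trans_lt hyR
  have hy0 : 0 < ‖y‖ := norm_pos_iff.2 hy
  by_cases h : 0 ≤ Real.log R - Real.log ‖y‖ - 1
  swap
  · rw [ENNReal.ofReal_of_nonpos (not_le.1 h).le]
    exact zero_le
  unfold discKernel
  rw [Set.indicator_of_mem (by simpa using hyR)]
  refine ENNReal.le_sub_of_add_le_right ?_ ?_
  · exact ((discAvg_logPot_le hT1 hR hy (by linarith)).trans_lt ENNReal.ofReal_lt_top).ne
  · refine (add_le_add_right (discAvg_logPot_le_add_one hT1 hR hy (by linarith)) _).trans ?_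
    rw [← ENNReal.ofReal_add h]
    · unfold logPot
      exact ENNReal.ofReal_le_ofReal (by linarith)
    · have := Real.log_le_log hR (by linarith : R ≤ T)
      linarith

lemma discAvg_discKernel_eq_zero {y : ℂ} (h : R + ρ ≤ ‖y‖) :
    discAvg ρ (discKernel T R) y = 0 := by
  have : discAvg ρ (discKernel T R) y = discAvg ρ (fun _ => 0) y := by
    refine discAvg_congr_ae fun x hx _ => discKernel_of_le ?_
    have h2 : dist x y < ρ := hx
    rw [dist_eq_norm] at h2
    have := norm_le_norm_add_norm_sub x y
    linarith
  rw [this]; simp [discAvg]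

/-- Both sides become `log (T / |y|)` after adding the double average `A_ρ A_R` of the logarithm,
which is symmetric in `ρ` and `R` and finite here, hence can be cancelled. This is the substitute
for taking Laplacians. Far from the origin every term vanishes. -/
lemma discKernel_comm (hT1 : 1 ≤ T) (hR : 0 < R) (hρ : 0 < ρ) (hT : 2 * (R + ρ) ≤ T)
    (hy : y ≠ 0) :
    discKernel T ρ y + discAvg ρ (discKernel T R) y =
      discKernel T R y + discAvg R (discKernel T ρ) y := by
  have key : ∀ R ρ, 0 < R → 0 < ρ → 2 * (R + ρ) ≤ T → ‖y‖ < R + ρ →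
      discKernel T ρ y + discAvg ρ (discKernel T R) y + discAvg ρ (discAvg R (logPot T)) y =
      logPot T y := by
    intro R ρ hR hρ hT h
    have h1 : discAvg ρ (discKernel T R) y + discAvg ρ (discAvg R (logPot T)) y =
        discAvg ρ (logPot T) y := by
      rw [← discAvg_add (measurable_discKernel T R)]
      refine discAvg_congr_ae fun x hx hx0 => discKernel_add_discAvg hT1 hR hx0 ?_
      have : ‖x‖ ≤ ‖y‖ + ρ := by
        have h2 : dist x y < ρ := hx
        rw [dist_eq_norm] at h2
        have := norm_le_norm_add_norm_sub y x
        rw [norm_sub_rev] at this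
        linarith
      linarith
    rw [add_assoc, h1, discKernel_add_discAvg hT1 hρ hy (by linarith)]
  by_cases h : ‖y‖ < R + ρ
  · have h1 := key R ρ hR hρ hT h
    have h2 := key ρ R hρ hR (by linarith) (by linarith)
    rw [discAvg_comm (measurable_logPot T) R ρ, ← h1] at h2
    refine ((ENNReal.add_left_inj ?_).1 h2).symm
    intro htop
    rw [htop, add_top] at h1
    exact ENNReal.ofReal_ne_top h1.symm
  · rw [not_lt] at h
    rw [discAvg_discKernel_eq_zero h, discAvg_discKernel_eq_zero (by linarith),
      discKernel_of_le (by linarith),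
      discKernel_of_le (by linarith)]

end discKernel

/-! ### Integrability of the kernels -/

lemma lintegral_ball_norm_rpow {R p : ℝ} (hR : 0 < R) (hp : p < 2) :
    ∫⁻ y in Metric.ball (0:ℂ) R, ENNReal.ofReal ((R / ‖y‖) ^ p) < ⊤ := by
  have hm : Measurable fun y : ℂ => ENNReal.ofReal ((R / ‖y‖) ^ p) := by fun_prop
  rw [lintegral_ball_eq_polar hm]
  have h1 : ∀ s ∈ Set.Ioo 0 R, ENNReal.ofReal s * ∫⁻ t in Set.Ioc 0 (2 * Real.pi),
      ENNReal.ofReal ((R / ‖circleMap 0 s t‖) ^ p) =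
      ENNReal.ofReal (2 * Real.pi * R ^ p) * ENNReal.ofReal (s ^ (1 - p)) := by
    intro s hs
    have hs0 := hs.1
    simp only [norm_circleMap_zero, abs_of_pos hs0, lintegral_const, Measure.restrict_apply_univ,
      Real.volume_Ioc, sub_zero]
    rw [← ENNReal.ofReal_mul (by positivity), ← ENNReal.ofReal_mul hs0.le,
      ← ENNReal.ofReal_mul (by positivity), Real.div_rpow hR.le hs0.le, Real.rpow_sub hs0,
      Real.rpow_one]
    congr 1
    field_simp
  rw [setLIntegral_congr_fun measurableSet_Ioo h1, lintegral_const_mul _ (by fun_prop)]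
  refine ENNReal.mul_lt_top ENNReal.ofReal_lt_top ?_
  have h2 : IntegrableOn (fun s : ℝ => s ^ (1 - p)) (Set.Ioo 0 R) :=
    (intervalIntegral.integrableOn_Ioo_rpow_iff hR).2 (by linarith)
  exact h2.lintegral_lt_top

lemma lintegral_discKernel_lt_top {T R : ℝ} (hT1 : 1 ≤ T) (hR : 0 < R) (hT : 2 * R ≤ T) :
    ∫⁻ y, discKernel T R y < ⊤ := by
  refine lt_of_le_of_lt ?_ (lintegral_ball_norm_rpow hR (by norm_num : (1:ℝ) < 2))
  rw [← lintegral_indicator measurableSet_ball]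
  refine lintegral_mono_ae ?_
  filter_upwards [compl_mem_ae_iff.2 (measure_singleton (0:ℂ))] with y hy
  have hy0 : 0 < ‖y‖ := norm_pos_iff.2 hy
  by_cases h : ‖y‖ < R
  · rw [Set.indicator_of_mem (by simpa using h)]
    refine (discKernel_le hT1 hT hy h.le).trans (ENNReal.ofReal_le_ofReal ?_)
    rw [← Real.log_div hR.ne' hy0.ne', Real.rpow_one]
    exact (Real.log_le_sub_one_of_pos (by positivity)).trans (by linarith)
  · rw [discKernel_of_le (not_lt.1 h)]; exact zero_le

/-- The kernel is at least `log (R / |y|) - 1 ≥ 1` on the disc of radius `R / e²`, away from the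
origin. Positivity lets the kernel be normalized to a mollifier. -/
lemma lintegral_discKernel_pos {T R : ℝ} (hT1 : 1 ≤ T) (hR : 0 < R) (hT : 2 * R ≤ T) :
    ∫⁻ y, discKernel T R y ≠ 0 := by
  have h1 : ∫⁻ _ in Metric.ball (0:ℂ) (R / Real.exp 2), 1 ≤ ∫⁻ y, discKernel T R y := by
    rw [← lintegral_indicator measurableSet_ball]
    refine lintegral_mono_ae ?_
    filter_upwards [compl_mem_ae_iff.2 (measure_singleton (0:ℂ))] with y hy
    by_cases h : y ∈ Metric.ball (0:ℂ) (R / Real.exp 2)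
    · rw [Set.indicator_of_mem h]
      have hy0 : 0 < ‖y‖ := norm_pos_iff.2 hy
      have h' : ‖y‖ < R / Real.exp 2 := by simpa using h
      have h2 : ‖y‖ < R := h'.trans (div_lt_self hR (Real.one_lt_exp_iff.2 (by norm_num)))
      refine le_trans ?_ (le_discKernel hT1 hT hy h2)
      rw [← ENNReal.ofReal_one]
      refine ENNReal.ofReal_le_ofReal ?_
      have := Real.log_le_log hy0 h'.le
      rw [Real.log_div hR.ne' (Real.exp_ne_zero _), Real.log_exp] at this
      linarith
    · rw [Set.indicator_of_notMem h]; exact zero_le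
  intro h0
  rw [h0] at h1
  have h2 : 0 < R / Real.exp 2 := by positivity
  simp at h1
  exact absurd (Metric.measure_ball_pos volume (0:ℂ) h2).ne' (by simp [h1])

/-! ### Mollified Riesz decomposition and Riesz mass -/

section estimate
variable {T R ρ : ℝ} {f : ℂ → ENNReal}

lemma lintegral_mul_discAvg_lt_top (hf : ∫⁻ w, f w < ⊤) (hρ : 0 < ρ) {g : ℂ → ENNReal}
    (hg : ∫⁻ y, g y < ⊤) (z : ℂ) (hgm : Measurable g) :
    ∫⁻ w, g (z - w) * discAvg ρ f w < ⊤ := by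
  calc ∫⁻ w, g (z - w) * discAvg ρ f w
      ≤ ∫⁻ w, g (z - w) * ((ENNReal.ofReal (Real.pi * ρ ^ 2))⁻¹ * ∫⁻ y, f y) := by
        gcongr with w
        exact discAvg_le_lintegral ρ f w
    _ = (∫⁻ y, g y) * ((ENNReal.ofReal (Real.pi * ρ ^ 2))⁻¹ * ∫⁻ y, f y) := by
        rw [lintegral_mul_const _ (by fun_prop), lintegral_sub_left_eq_self g z]
    _ < ⊤ := by
        refine ENNReal.mul_lt_top hg (ENNReal.mul_lt_top ?_ hf)
        rw [ENNReal.inv_lt_top]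
        have : 0 < Real.pi * ρ ^ 2 := by positivity
        simpa using this

/-- Riesz decomposition, in mollified form, on the disc of radius `R` about `z`. -/
lemma lintegral_discKernel_mul_le (hf : Measurable f) (hfi : ∫⁻ w, f w < ⊤) (hT1 : 1 ≤ T)
    (hR : 0 < R) (hρ : 0 < ρ) (hT : 2 * (R + ρ) ≤ T) (z : ℂ) :
    ∫⁻ w, discKernel T ρ (z - w) * f w ≤
      (ENNReal.ofReal (Real.pi * R ^ 2))⁻¹ * (∫⁻ y, discKernel T ρ y) * (∫⁻ w, f w) +
        ∫⁻ w, discKernel T R (z - w) * (f w - discAvg ρ f w) := by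
  have hβ := measurable_discKernel T R
  have hβρ := measurable_discKernel T ρ
  have hav := measurable_discAvg (R := ρ) hf
  have hav2 := measurable_discAvg (R := ρ) hβ
  have hav3 := measurable_discAvg (R := R) hβρ
  set X := ∫⁻ w, discKernel T R (z - w) * discAvg ρ f w with hX
  have hXt : X ≠ ⊤ := (lintegral_mul_discAvg_lt_top hfi hρ
    (lintegral_discKernel_lt_top hT1 hR (by linarith)) z hβ).ne
  -- The kernel identity integrated against `f`, with `A_ρ` moved from the kernel to `f` by
  -- self-adjointness. The finite term `X` is carried on both sides, to be cancelled without
  -- subtracting in `ENNReal`.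
  have h1 : (∫⁻ w, discKernel T ρ (z - w) * f w) + X =
      (∫⁻ w, f w * discAvg R (discKernel T ρ) (z - w)) + ∫⁻ w, discKernel T R (z - w) * f w := by
    rw [hX, ← lintegral_mul_discAvg_comm hf hβ, ← lintegral_add_left (by fun_prop),
      ← lintegral_add_left (by fun_prop)]
    refine lintegral_congr_ae ?_
    filter_upwards [compl_mem_ae_iff.2 (measure_singleton z)] with w hw
    have hzw : z - w ≠ 0 := sub_ne_zero.2 (Ne.symm hw)
    have := discKernel_comm hT1 hR hρ hT hzw
    calc _ = f w * (discKernel T ρ (z - w) + discAvg ρ (discKernel T R) (z - w)) := by ring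
      _ = _ := by rw [this]; ring
  -- Truncated subtraction errs only in the favourable direction, so this step does not use `A_ρ f ≤
  -- f`.
  have h2 : ∫⁻ w, discKernel T R (z - w) * f w ≤
      (∫⁻ w, discKernel T R (z - w) * (f w - discAvg ρ f w)) + X := by
    rw [hX, ← lintegral_add_left (by fun_prop)]
    gcongr with w
    rw [← mul_add]
    gcongr
    exact le_tsub_add
  have h3 : ∫⁻ w, f w * discAvg R (discKernel T ρ) (z - w) ≤
      (ENNReal.ofReal (Real.pi * R ^ 2))⁻¹ * (∫⁻ y, discKernel T ρ y) * (∫⁻ w, f w) := by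
    rw [← lintegral_const_mul _ hf]
    refine lintegral_mono fun w => ?_
    rw [mul_comm]
    gcongr
    exact discAvg_le_lintegral _ _ _
  refine (ENNReal.add_le_add_iff_right hXt).1 ?_
  rw [h1, add_assoc]
  exact add_le_add h3 h2

/-- Bound for the mollified Riesz mass of a disc. -/
lemma mass_le {R₁ R₂ : ℝ} (hf : Measurable f) (hfi : ∫⁻ w, f w < ⊤) (hT1 : 1 ≤ T)
    (hR₂ : 0 < R₂) (hρ : 0 < ρ) (hT : 2 * (R₁ + ρ) ≤ T) {a : ℂ}
    (hlog : 1 ≤ Real.log R₁ - Real.log R₂) (hR₁ : R₂ ≤ R₁)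
    (hsup : ∀ w ∈ Metric.ball a R₁, discAvg ρ f w ≤ f w) :
    ENNReal.ofReal (Real.log R₁ - Real.log R₂ - 1) *
        ∫⁻ w in Metric.ball a R₂, (f w - discAvg ρ f w) ≤
      (∫⁻ y, discKernel T ρ y) * ((ENNReal.ofReal (Real.pi * R₂ ^ 2))⁻¹ *
        ∫⁻ w in Metric.ball a (R₂ + ρ), f w) := by
  have hR₁0 : 0 < R₁ := hR₂.trans_le hR₁
  have hβ1 := measurable_discKernel T R₁
  have hβ2 := measurable_discKernel T R₂
  have hβρ := measurable_discKernel T ρ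
  -- Off the origin this difference of kernels is nonnegative, and at least `log (R₁ / R₂) - 1`
  -- where `|y| < R₂`. Testing `f - A_ρ f` against it therefore detects the mass of the small disc
  -- with a logarithmic weight.
  set d : ℂ → ENNReal := fun y => discKernel T R₁ y - discKernel T R₂ y with hd
  have hdm : Measurable d := hβ1.sub hβ2
  have hav := measurable_discAvg (R := ρ) hf
  have hav2 := measurable_discAvg (R := ρ) hdm
  have hav3 := measurable_discAvg (R := R₂) hβρ
  have hle : ∀ y, y ≠ 0 → discKernel T R₂ y ≤ discKernel T R₁ y := by
    intro y hy
    by_cases h : R₂ ≤ ‖y‖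
    · rw [discKernel_of_le h]; exact zero_le
    · rw [not_le] at h
      refine (discKernel_le hT1 (by linarith) hy h.le).trans (le_trans ?_
        (le_discKernel hT1 (by linarith) hy (h.trans_le hR₁)))
      exact ENNReal.ofReal_le_ofReal (by linarith)
  have hβ2t : ∀ y, y ≠ 0 → discKernel T R₂ y ≠ ⊤ := by
    intro y hy
    by_cases h : R₂ ≤ ‖y‖
    · rw [discKernel_of_le h]; simp
    · exact ((discKernel_le hT1 (by linarith) hy (not_le.1 h).le).trans_lt
        ENNReal.ofReal_lt_top).ne
  -- The kernel identities for `R₁` and `R₂` subtracted. The nonnegative term `A_{R₁} β_ρ` is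
  -- discarded.
  have hker : ∀ y, y ≠ 0 → d y ≤ discAvg R₂ (discKernel T ρ) y + discAvg ρ d y := by
    intro y hy
    have e1 := discKernel_comm hT1 hR₁0 hρ (by linarith) hy
    have e2 := discKernel_comm hT1 hR₂ hρ (by linarith) hy
    have e3 : discAvg ρ (discKernel T R₁) y =
        discAvg ρ (discKernel T R₂) y + discAvg ρ d y := by
      rw [← discAvg_add hβ2]
      refine discAvg_congr_ae fun x _ hx => ?_
      exact (add_tsub_cancel_of_le (hle x hx)).symm
    have e4 : discKernel T R₁ y = discKernel T R₂ y + d y :=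
      (add_tsub_cancel_of_le (hle y hy)).symm
    rw [e3, ← add_assoc, e2, e4] at e1
    have e5 : discKernel T R₂ y + (discAvg R₂ (discKernel T ρ) y + discAvg ρ d y) =
        discKernel T R₂ y + (d y + discAvg R₁ (discKernel T ρ) y) := by
      rw [← add_assoc, ← add_assoc, e1]
    rw [(ENNReal.add_right_inj (hβ2t y hy)).1 e5]
    exact le_self_add
  have hL : ∀ y, y ≠ 0 → ‖y‖ < R₂ → ENNReal.ofReal (Real.log R₁ - Real.log R₂ - 1) ≤ d y := by
    intro y hy h
    refine ENNReal.le_sub_of_add_le_right (hβ2t y hy) ?_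
    refine le_trans ?_ (le_discKernel hT1 (by linarith) hy (h.trans_le hR₁))
    refine (add_le_add_right (discKernel_le hT1 (by linarith) hy h.le) _).trans ?_
    rw [← ENNReal.ofReal_add (by linarith)
      (sub_nonneg.2 (Real.log_le_log (norm_pos_iff.2 hy) h.le))]
    exact ENNReal.ofReal_le_ofReal (by linarith)
  set X := ∫⁻ w, d (a - w) * discAvg ρ f w with hX
  have hdi : ∫⁻ y, d y < ⊤ := lt_of_le_of_lt (lintegral_mono fun y => tsub_le_self)
    (lintegral_discKernel_lt_top hT1 hR₁0 (by linarith))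
  have hXt : X ≠ ⊤ := (lintegral_mul_discAvg_lt_top hfi hρ hdi a hdm).ne
  have h1 : (∫⁻ w, d (a - w) * (f w - discAvg ρ f w)) + X ≤
      (∫⁻ w, f w * discAvg R₂ (discKernel T ρ) (a - w)) + X := by
    rw [hX]
    conv_rhs => rw [← lintegral_mul_discAvg_comm hf hdm]
    rw [← lintegral_add_left (by fun_prop), ← lintegral_add_left (by fun_prop)]
    refine lintegral_mono_ae ?_
    filter_upwards [compl_mem_ae_iff.2 (measure_singleton a)] with w hw
    have haw : a - w ≠ 0 := sub_ne_zero.2 (Ne.symm hw)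
    by_cases h : w ∈ Metric.ball a R₁
    · rw [← mul_add, tsub_add_cancel_of_le (hsup w h), ← mul_add, mul_comm]
      gcongr
      exact hker _ haw
    · have : d (a - w) = 0 := by
        simp only [hd]
        rw [discKernel_of_le]
        · simp
        · simpa [dist_eq_norm, norm_sub_rev] using h
      simp [this]
  have h2 := (ENNReal.add_le_add_iff_right hXt).1 h1
  calc _ = ∫⁻ w in Metric.ball a R₂,
        ENNReal.ofReal (Real.log R₁ - Real.log R₂ - 1) * (f w - discAvg ρ f w) := by
        rw [lintegral_const_mul _ (by fun_prop)]
    _ ≤ ∫⁻ w in Metric.ball a R₂, d (a - w) * (f w - discAvg ρ f w) := by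
        refine setLIntegral_mono_ae (by fun_prop) ?_
        filter_upwards [compl_mem_ae_iff.2 (measure_singleton a)] with w hw hwb
        gcongr
        refine hL _ (sub_ne_zero.2 (Ne.symm hw)) ?_
        rwa [← dist_eq_norm, dist_comm]
    _ ≤ ∫⁻ w, d (a - w) * (f w - discAvg ρ f w) := setLIntegral_le_lintegral _ _
    _ ≤ _ := h2
    _ ≤ ∫⁻ w, (Metric.ball a (R₂ + ρ)).indicator (fun w => (∫⁻ y, discKernel T ρ y) *
          (ENNReal.ofReal (Real.pi * R₂ ^ 2))⁻¹ * f w) w := by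
        refine lintegral_mono fun w => ?_
        by_cases h : w ∈ Metric.ball a (R₂ + ρ)
        · rw [Set.indicator_of_mem h, mul_comm]
          gcongr
          rw [mul_comm]
          exact discAvg_le_lintegral _ _ _
        · rw [discAvg_discKernel_eq_zero, mul_zero]; · exact zero_le
          rw [add_comm]
          simpa [dist_eq_norm, norm_sub_rev] using h
    _ = _ := by
        rw [lintegral_indicator measurableSet_ball, lintegral_const_mul _ hf, mul_assoc]

end estimate

/-! ### Exponential integrability under small Riesz mass -/

/-- `exp (γ x)` for `x ∈ [0, ∞]`. -/
noncomputable def expPow (γ : ℝ) (x : ENNReal) : ENNReal := EReal.exp (x : EReal) ^ γ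

section expPow
variable {γ : ℝ}

lemma expPow_ofReal {t : ℝ} (ht : 0 ≤ t) :
    expPow γ (ENNReal.ofReal t) = ENNReal.ofReal (Real.exp (γ * t)) := by
  unfold expPow
  rw [EReal.coe_ennreal_ofReal, max_eq_left ht, EReal.exp_coe,
    ENNReal.ofReal_rpow_of_pos (Real.exp_pos t), ← Real.exp_mul, mul_comm]

lemma expPow_zero : expPow γ 0 = 1 := by simp [expPow]

lemma expPow_top (hγ : 0 < γ) : expPow γ ⊤ = ⊤ := by simp [expPow, hγ]

lemma expPow_mono (hγ : 0 ≤ γ) : Monotone (expPow γ) := fun x y h => by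
  unfold expPow
  gcongr
  exact EReal.coe_ennreal_le_coe_ennreal_iff.2 h

lemma expPow_add (hγ : 0 ≤ γ) (x y : ENNReal) :
    expPow γ (x + y) = expPow γ x * expPow γ y := by
  unfold expPow
  rw [EReal.coe_ennreal_add, EReal.exp_add, ENNReal.mul_rpow_of_nonneg _ _ hγ]

lemma continuous_expPow : Continuous (expPow γ) :=
  ENNReal.continuous_rpow_const.comp (ENNReal.continuous_exp.comp continuous_coe_ennreal_ereal)

lemma expPow_lt_top {x : ENNReal} (hx : x ≠ ⊤) : expPow γ x < ⊤ := by
  rw [← ENNReal.ofReal_toReal hx, expPow_ofReal ENNReal.toReal_nonneg]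
  exact ENNReal.ofReal_lt_top

/-- Jensen's inequality for the exponential function. -/
lemma expPow_lintegral_le {α : Type*} [MeasurableSpace α] {μ : Measure α} {θ : ℝ}
    (hγ : 0 < γ) (hθ : 0 < θ) (hμ : μ Set.univ ≤ ENNReal.ofReal θ) {g : α → ENNReal}
    (hg : Measurable g) :
    expPow γ (∫⁻ x, g x ∂μ) ≤ 1 + (μ Set.univ)⁻¹ * ∫⁻ x, expPow (γ * θ) (g x) ∂μ := by
  have hfin : IsFiniteMeasure μ := ⟨hμ.trans_lt ENNReal.ofReal_lt_top⟩
  -- The summand `1` in the conclusion is for the zero measure, where the mean term is `∞ * 0 = 0`.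
  rcases eq_or_ne μ 0 with rfl | hμ0
  · simp [expPow_zero]
  have : NeZero μ := ⟨hμ0⟩
  have hm0 : μ Set.univ ≠ 0 := by simpa using hμ0
  by_cases htop : ∫⁻ x, expPow (γ * θ) (g x) ∂μ = ⊤
  · rw [htop, ENNReal.mul_top (ENNReal.inv_ne_zero.2 (measure_ne_top μ _))]
    simp
  have hp : 0 < γ * θ := by positivity
  have hEm : Measurable fun x => expPow (γ * θ) (g x) := continuous_expPow.measurable.comp hg
  have hgt : ∀ᵐ x ∂μ, g x ≠ ⊤ := by
    filter_upwards [ae_lt_top hEm htop] with x hx h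
    rw [h, expPow_top hp] at hx
    exact lt_irrefl _ hx
  set G : α → ℝ := fun x => (g x).toReal with hG
  have hE : ∀ᵐ x ∂μ, expPow (γ * θ) (g x) = ENNReal.ofReal (Real.exp (γ * θ * G x)) := by
    filter_upwards [hgt] with x hx
    rw [← expPow_ofReal ENNReal.toReal_nonneg, ENNReal.ofReal_toReal hx]
  have hi1 : Integrable (fun x => Real.exp (γ * θ * G x)) μ := by
    refine ⟨(by fun_prop), ?_⟩
    rw [hasFiniteIntegral_iff_ofReal (ae_of_all _ fun x => (Real.exp_pos _).le),
      ← lintegral_congr_ae hE]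
    exact lt_top_iff_ne_top.2 htop
  have hi2 : Integrable (fun x => γ * θ * G x) μ := by
    refine hi1.mono' (by fun_prop) (ae_of_all _ fun x => ?_)
    have h0 : 0 ≤ γ * θ * G x := mul_nonneg hp.le ENNReal.toReal_nonneg
    rw [Real.norm_of_nonneg h0]
    linarith [Real.add_one_le_exp (γ * θ * G x)]
  have hi3 : Integrable G μ := by
    have := hi2.const_mul (γ * θ)⁻¹
    refine this.congr (ae_of_all _ fun x => ?_)
    field_simp
  have h1 : ∫⁻ x, g x ∂μ = ENNReal.ofReal (∫ x, G x ∂μ) := by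
    rw [ofReal_integral_eq_lintegral_ofReal hi3 (ae_of_all _ fun x => ENNReal.toReal_nonneg)]
    refine lintegral_congr_ae ?_
    filter_upwards [hgt] with x hx
    exact (ENNReal.ofReal_toReal hx).symm
  have hJ0 : 0 ≤ ∫ x, G x ∂μ := integral_nonneg fun x => ENNReal.toReal_nonneg
  have h2 := convexOn_exp.map_average_le (μ := μ) Real.continuous_exp.continuousOn isClosed_univ
    (f := fun x => γ * θ * G x) (by simp) hi2 hi1
  rw [average_eq, average_eq, integral_const_mul, smul_eq_mul, smul_eq_mul] at h2
  set m := μ.real Set.univ with hm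
  have hmpos : 0 < m := measureReal_univ_pos
  have hmθ : m ≤ θ := by
    rw [hm, Measure.real]
    exact ENNReal.toReal_le_of_le_ofReal hθ.le hμ
  have h3 : γ * ∫ x, G x ∂μ ≤ m⁻¹ * (γ * θ * ∫ x, G x ∂μ) := by
    have : 1 ≤ m⁻¹ * θ := by rw [inv_mul_eq_div, one_le_div hmpos]; exact hmθ
    calc γ * ∫ x, G x ∂μ = 1 * (γ * ∫ x, G x ∂μ) := by ring
      _ ≤ (m⁻¹ * θ) * (γ * ∫ x, G x ∂μ) := by gcongr
      _ = _ := by ring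
  rw [h1, expPow_ofReal hJ0]
  refine le_add_left ?_
  rw [lintegral_congr_ae hE, ← ofReal_integral_eq_lintegral_ofReal hi1
    (ae_of_all _ fun x => (Real.exp_pos _).le)]
  have h4 : (μ Set.univ)⁻¹ = ENNReal.ofReal m⁻¹ := by
    rw [ENNReal.ofReal_inv_of_pos hmpos, hm, Measure.real,
      ENNReal.ofReal_toReal (measure_ne_top _ _)]
  rw [h4, ← ENNReal.ofReal_mul (by positivity)]
  exact ENNReal.ofReal_le_ofReal ((Real.exp_le_exp.2 h3).trans h2)

lemma expPow_discKernel_le (hγ : 0 ≤ γ) {T R : ℝ} (hT1 : 1 ≤ T) (hR : 0 < R) (hT : 2 * R ≤ T)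
    {y : ℂ} (hy : y ≠ 0) :
    expPow γ (discKernel T R y) ≤
      1 + (Metric.ball (0:ℂ) R).indicator (fun y => ENNReal.ofReal ((R / ‖y‖) ^ γ)) y := by
  have hy0 : 0 < ‖y‖ := norm_pos_iff.2 hy
  by_cases h : ‖y‖ < R
  · rw [Set.indicator_of_mem (by simpa using h)]
    refine le_add_left ((expPow_mono hγ (discKernel_le hT1 hT hy h.le)).trans ?_)
    rw [expPow_ofReal (sub_nonneg.2 (Real.log_le_log hy0 h.le)), ← Real.log_div hR.ne' hy0.ne',
      Real.rpow_def_of_pos (by positivity), mul_comm]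
  · rw [discKernel_of_le (not_lt.1 h), expPow_zero]
    exact le_self_add

end expPow

/-- Uniform exponential integrability of the mollifications of a superharmonic function. -/
lemma lintegral_expPow_mollify_le {f : ℂ → ENNReal} (hf : Measurable f) (hfi : ∫⁻ w, f w < ⊤)
    {a : ℂ} {T R₁ R₂ ρ γ θ : ℝ} (hT1 : 1 ≤ T) (hR₂ : 0 < R₂) (hR : R₂ ≤ R₁) (hρ : 0 < ρ)
    (hT : 2 * (R₁ + ρ) ≤ T) (hlog : 1 < Real.log R₁ - Real.log R₂)
    (hsup : ∀ w ∈ Metric.ball a R₁, discAvg ρ f w ≤ f w) (hγ : 0 < γ) (hθ : 0 < θ)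
    (hmass : (ENNReal.ofReal (Real.pi * R₂ ^ 2))⁻¹ * ∫⁻ w in Metric.ball a (R₂ + ρ), f w ≤
      ENNReal.ofReal (θ * (Real.log R₁ - Real.log R₂ - 1))) :
    ∫⁻ z in Metric.ball a (R₂ / 4), expPow γ
        ((∫⁻ y, discKernel T ρ y)⁻¹ * ∫⁻ w, discKernel T ρ (z - w) * f w) ≤
      expPow γ ((ENNReal.ofReal (Real.pi * (R₂ / 2) ^ 2))⁻¹ * ∫⁻ w, f w) *
        (2 * volume (Metric.ball a (R₂ / 4)) + ∫⁻ y in Metric.ball (0:ℂ) (R₂ / 2),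
          ENNReal.ofReal ((R₂ / 2 / ‖y‖) ^ (γ * θ))) := by
  set c := ∫⁻ y, discKernel T ρ y with hc
  have hc0 : c ≠ 0 := lintegral_discKernel_pos hT1 hρ (by linarith)
  have hct : c ≠ ⊤ := (lintegral_discKernel_lt_top hT1 hρ (by linarith)).ne
  -- For `z` within `R₂ / 4` of `a`, the disc of radius `R₂ / 2` about `z` stays inside the disc of
  -- radius `R₂` about `a`. The local potential thus sees only mass that `mass_le` controls.
  set R := R₂ / 2 with hRdef
  have hR0 : 0 < R := by positivity
  have hTR : 2 * (R + ρ) ≤ T := by linarith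
  set ν : ℂ → ENNReal := fun w => c⁻¹ * (f w - discAvg ρ f w) with hν
  have hav := measurable_discAvg (R := ρ) hf
  have hβ := measurable_discKernel T R
  have hνm : Measurable ν := by fun_prop
  set μ := (volume.restrict (Metric.ball a R₂)).withDensity ν with hμ
  set A := (ENNReal.ofReal (Real.pi * R ^ 2))⁻¹ * ∫⁻ w, f w with hA
  set B := Metric.ball a (R₂ / 4) with hB
  have hmμ : μ Set.univ ≤ ENNReal.ofReal θ := by
    rw [hμ, withDensity_apply _ MeasurableSet.univ, Measure.restrict_univ,
      lintegral_const_mul _ (by fun_prop)]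
    have h1 := mass_le hf hfi hT1 hR₂ hρ hT hlog.le hR hsup
    have h2 := h1.trans (mul_le_mul_right hmass c)
    rw [mul_comm θ, ENNReal.ofReal_mul (by linarith), mul_left_comm] at h2
    have hL0 : ENNReal.ofReal (Real.log R₁ - Real.log R₂ - 1) ≠ 0 := by
      simp only [ne_eq, ENNReal.ofReal_eq_zero, not_le]
      linarith
    have h3 := (ENNReal.mul_le_mul_iff_right hL0 ENNReal.ofReal_ne_top).1 h2
    calc _ ≤ c⁻¹ * (c * ENNReal.ofReal θ) := by gcongr
      _ = _ := by rw [← mul_assoc, ENNReal.inv_mul_cancel hc0 hct, one_mul]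
  have hF : ∀ z ∈ B, c⁻¹ * ∫⁻ w, discKernel T ρ (z - w) * f w ≤
      A + ∫⁻ w, discKernel T R (z - w) ∂μ := by
    intro z hz
    calc _ ≤ c⁻¹ * ((ENNReal.ofReal (Real.pi * R ^ 2))⁻¹ * c * (∫⁻ w, f w) +
        ∫⁻ w, discKernel T R (z - w) * (f w - discAvg ρ f w)) := by
          gcongr
          exact lintegral_discKernel_mul_le hf hfi hT1 hR0 hρ hTR z
      _ = A + c⁻¹ * ∫⁻ w, discKernel T R (z - w) * (f w - discAvg ρ f w) := by
          rw [mul_add, hA]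
          congr 1
          calc _ = (c⁻¹ * c) * ((ENNReal.ofReal (Real.pi * R ^ 2))⁻¹ * ∫⁻ w, f w) := by ring
            _ = _ := by rw [ENNReal.inv_mul_cancel hc0 hct, one_mul]
      _ = A + ∫⁻ w in Metric.ball a R₂, discKernel T R (z - w) * ν w := by
          congr 1
          rw [← lintegral_const_mul _ (by fun_prop), ← lintegral_indicator measurableSet_ball]
          refine lintegral_congr fun w => ?_
          by_cases h : w ∈ Metric.ball a R₂
          · rw [Set.indicator_of_mem h, hν]; ring
          · rw [Set.indicator_of_notMem h, discKernel_of_le, zero_mul, mul_zero]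
            rw [← dist_eq_norm]
            have h1 : R₂ ≤ dist w a := by simpa using h
            have h2 : dist z a < R₂ / 4 := hz
            have := dist_triangle_left w a z
            linarith
      _ = _ := by
          rw [hμ, lintegral_withDensity_eq_lintegral_mul _ hνm (by fun_prop)]
          simp only [Pi.mul_apply, mul_comm]
  set p := γ * θ with hp
  have hp0 : 0 < p := by positivity
  set Q := ∫⁻ y in Metric.ball (0:ℂ) R, ENNReal.ofReal ((R / ‖y‖) ^ p) with hQ
  have hinner : ∀ w, ∫⁻ z in B, expPow p (discKernel T R (z - w)) ≤ volume B + Q := by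
    intro w
    set ind := (Metric.ball (0:ℂ) R).indicator (fun y => ENNReal.ofReal ((R / ‖y‖) ^ p)) with hind
    calc _ ≤ ∫⁻ z in B, (1 + ind (z - w)) := by
          refine lintegral_mono_ae (ae_restrict_of_ae ?_)
          filter_upwards [compl_mem_ae_iff.2 (measure_singleton w)] with z hz
          exact expPow_discKernel_le hp0.le hT1 hR0 (by linarith) (sub_ne_zero.2 hz)
      _ = volume B + ∫⁻ z in B, ind (z - w) := by
          rw [lintegral_add_left measurable_const]; simp
      _ ≤ volume B + ∫⁻ z, ind (z - w) := by
          gcongr 1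
          exact setLIntegral_le_lintegral _ _
      _ = _ := by
          rw [lintegral_sub_right_eq_self, hind, lintegral_indicator measurableSet_ball]
  have hjm : Measurable fun q : ℂ × ℂ => expPow p (discKernel T R (q.1 - q.2)) :=
    continuous_expPow.measurable.comp (hβ.comp (by fun_prop))
  have hsf : SFinite μ := by rw [hμ]; infer_instance
  calc _ ≤ ∫⁻ z in B, expPow γ A * (1 + (μ Set.univ)⁻¹ *
        ∫⁻ w, expPow p (discKernel T R (z - w)) ∂μ) := by
        refine setLIntegral_mono' measurableSet_ball fun z hz => ?_
        refine (expPow_mono hγ.le (hF z hz)).trans ?_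
        rw [expPow_add hγ.le]
        gcongr
        exact expPow_lintegral_le hγ hθ hmμ (by fun_prop)
    _ = expPow γ A * (volume B + (μ Set.univ)⁻¹ *
        ∫⁻ z in B, ∫⁻ w, expPow p (discKernel T R (z - w)) ∂μ) := by
        have hm2 : Measurable fun z => ∫⁻ w, expPow p (discKernel T R (z - w)) ∂μ :=
          hjm.lintegral_prod_right'
        rw [lintegral_const_mul _ (by fun_prop), lintegral_add_left measurable_const,
          lintegral_const_mul _ hm2]
        simp
    _ = expPow γ A * (volume B + (μ Set.univ)⁻¹ *
        ∫⁻ w, (∫⁻ z in B, expPow p (discKernel T R (z - w))) ∂μ) := by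
        rw [lintegral_lintegral_swap hjm.aemeasurable]
    -- After exchanging the integrals, the inner one is bounded uniformly in `w`. The total mass
    -- then cancels against its inverse, so the bound depends neither on `μ` nor on `ρ`.
    _ ≤ expPow γ A * (volume B + (μ Set.univ)⁻¹ * ∫⁻ _, (volume B + Q) ∂μ) := by
        gcongr with w
        exact hinner w
    _ ≤ expPow γ A * (volume B + (volume B + Q)) := by
        gcongr
        rw [lintegral_const, mul_comm (volume B + Q), ← mul_assoc]
        calc _ ≤ 1 * (volume B + Q) := by gcongr; exact ENNReal.inv_mul_le_one _
          _ = _ := one_mul _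
    _ = _ := by rw [← add_assoc, two_mul]

/-- A superharmonic function of small Riesz mass near `a` is exponentially integrable. -/
lemma lintegral_expPow_lt_top {f : ℂ → ENNReal} (hf : Measurable f) (hfi : ∫⁻ w, f w < ⊤)
    {a : ℂ} {R₁ R₂ η γ θ : ℝ} (hR₂ : 0 < R₂) (hR : R₂ ≤ R₁) (hη : 0 < η)
    (hlog : 1 < Real.log R₁ - Real.log R₂)
    (hsup : ∀ w ∈ Metric.ball a R₁, ∀ ρ, 0 < ρ → ρ ≤ η → discAvg ρ f w ≤ f w)
    (hlsc : ∀ z ∈ Metric.ball a R₁, LowerSemicontinuousAt f z) (hγ : 0 < γ) (hθ : 0 < θ)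
    (hγθ : γ * θ < 2)
    (hmass : (ENNReal.ofReal (Real.pi * R₂ ^ 2))⁻¹ * ∫⁻ w in Metric.ball a (R₂ + η), f w ≤
      ENNReal.ofReal (θ * (Real.log R₁ - Real.log R₂ - 1))) :
    ∫⁻ z in Metric.ball a (R₂ / 4), expPow γ (f z) < ⊤ := by
  set T := max 1 (2 * (R₁ + η)) with hT
  have hT1 : 1 ≤ T := le_max_left _ _
  have hT2 : 2 * (R₁ + η) ≤ T := le_max_right _ _
  set ρ : ℕ → ℝ := fun n => η / (n + 1) with hρ
  have hρ0 : ∀ n, 0 < ρ n := fun n => by positivity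
  have hρη : ∀ n, ρ n ≤ η := fun n => div_le_self hη.le (by linarith [n.cast_nonneg (α := ℝ)])
  have hρt : Tendsto ρ atTop (𝓝 0) := by
    have := (tendsto_one_div_add_atTop_nhds_zero_nat (𝕜 := ℝ)).const_mul η
    simpa [hρ, div_eq_mul_inv] using this
  set F : ℕ → ℂ → ENNReal := fun n z =>
    (∫⁻ y, discKernel T (ρ n) y)⁻¹ * ∫⁻ w, discKernel T (ρ n) (z - w) * f w with hF
  have hFm : ∀ n, Measurable (F n) := fun n => by
    have hβ := measurable_discKernel T (ρ n)
    refine Measurable.const_mul ?_ _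
    exact Measurable.lintegral_prod_right'
      (f := fun q : ℂ × ℂ => discKernel T (ρ n) (q.1 - q.2) * f q.2) (by fun_prop)
  set K := expPow γ ((ENNReal.ofReal (Real.pi * (R₂ / 2) ^ 2))⁻¹ * ∫⁻ w, f w) *
        (2 * volume (Metric.ball a (R₂ / 4)) + ∫⁻ y in Metric.ball (0:ℂ) (R₂ / 2),
          ENNReal.ofReal ((R₂ / 2 / ‖y‖) ^ (γ * θ))) with hK
  have hKt : K < ⊤ := by
    refine ENNReal.mul_lt_top (expPow_lt_top (ENNReal.mul_lt_top ?_ hfi).ne)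
      (ENNReal.add_lt_top.2 ⟨ENNReal.mul_lt_top (by simp) measure_ball_lt_top,
        lintegral_ball_norm_rpow (by positivity) hγθ⟩)
    rw [ENNReal.inv_lt_top]
    have : 0 < Real.pi * (R₂ / 2) ^ 2 := by positivity
    simpa only [ENNReal.ofReal_pos] using this
  have hbd : ∀ n, ∫⁻ z in Metric.ball a (R₂ / 4), expPow γ (F n z) ≤ K := fun n => by
    refine lintegral_expPow_mollify_le hf hfi hT1 hR₂ hR (hρ0 n) (by linarith [hρη n]) hlog
      (fun w hw => hsup w hw _ (hρ0 n) (hρη n)) hγ hθ (le_trans ?_ hmass)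
    gcongr 1
    exact lintegral_mono_set (Metric.ball_subset_ball (by linarith [hρη n]))
  -- The normalized kernels have integral one and shrinking support, so lower semicontinuity bounds
  -- `f` by the lower limit of its mollifications, as Fatou's lemma requires.
  have hlim : ∀ z ∈ Metric.ball a (R₂ / 4),
      expPow γ (f z) ≤ liminf (fun n => expPow γ (F n z)) atTop := by
    intro z hz
    have h1 : f z ≤ liminf (fun n => F n z) atTop := by
      refine le_of_forall_lt fun s hs => ?_
      obtain ⟨s', hss', hs'⟩ := exists_between hs
      refine hss'.trans_le (le_liminf_of_le (by isBoundedDefault) ?_)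
      obtain ⟨ε, hε, hεs⟩ := Metric.mem_nhds_iff.1
        (hlsc z (Metric.ball_subset_ball (by linarith) hz) s' hs')
      filter_upwards [hρt.eventually_lt_const hε] with n hn
      have hc0 := lintegral_discKernel_pos (R := ρ n) hT1 (hρ0 n) (by linarith [hρη n])
      have hct := (lintegral_discKernel_lt_top (R := ρ n) hT1 (hρ0 n) (by linarith [hρη n])).ne
      have hβ := measurable_discKernel T (ρ n)
      calc s' = (∫⁻ y, discKernel T (ρ n) y)⁻¹ * ((∫⁻ y, discKernel T (ρ n) y) * s') := by
            rw [← mul_assoc, ENNReal.inv_mul_cancel hc0 hct, one_mul]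
        _ = (∫⁻ y, discKernel T (ρ n) y)⁻¹ * ∫⁻ w, discKernel T (ρ n) (z - w) * s' := by
            rw [lintegral_mul_const _ (by fun_prop), lintegral_sub_left_eq_self]
        _ ≤ F n z := by
            simp only [hF]
            gcongr 1
            refine lintegral_mono fun w => ?_
            by_cases h : w ∈ Metric.ball z ε
            · gcongr
              exact (hεs h).le
            · rw [discKernel_of_le, zero_mul]; · exact zero_le
              rw [← dist_eq_norm, dist_comm]
              have : ε ≤ dist w z := by simpa using h
              linarith
    refine (expPow_mono hγ.le h1).trans (le_of_eq ?_)
    exact (expPow_mono hγ.le).map_liminf_of_continuousAt _ continuous_expPow.continuousAt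
  calc _ ≤ ∫⁻ z in Metric.ball a (R₂ / 4), liminf (fun n => expPow γ (F n z)) atTop :=
        setLIntegral_mono' measurableSet_ball hlim
    _ ≤ liminf (fun n => ∫⁻ z in Metric.ball a (R₂ / 4), expPow γ (F n z)) atTop :=
        lintegral_liminf_le fun n => continuous_expPow.measurable.comp (hFm n)
    _ ≤ K := by
        refine liminf_le_of_le (by isBoundedDefault) fun b hb => ?_
        obtain ⟨n, hn⟩ := hb.exists
        exact hn.trans (hbd n)
    _ < ⊤ := hKt

/-! ### Three circles theorem and existence of the Lelong number -/

/-- A function that is monotone and convex in `log r` has a nonnegative slope at `-∞`. -/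
lemma exists_slope_of_logConvex {m : ℝ → ℝ} {R : ℝ} (hR : 0 < R)
    (hmono : ∀ r, 0 < r → r < R → m r ≤ m R)
    (hconv : ∀ r₁ r, 0 < r₁ → r₁ ≤ r → r < R →
      (m r₁ - m R) / (Real.log r₁ - Real.log R) ≤ (m r - m R) / (Real.log r - Real.log R)) :
    ∃ ν : ℝ, 0 ≤ ν ∧ Tendsto (fun r => m r / Real.log r) (𝓝[>] 0) (𝓝 ν) ∧
      ∀ r, 0 < r → r < R → m r ≤ m R + ν * (Real.log r - Real.log R) := by
  -- Secant slopes from `R` in the variable `log r`. They are nonnegative and increase with `r`, so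
  -- their infimum is their limit at `0`. That the infimum lies below every slope is the asserted
  -- upper bound for `m`.
  set S : ℝ → ℝ := fun r => (m r - m R) / (Real.log r - Real.log R) with hS
  have hneg : ∀ r, 0 < r → r < R → Real.log r - Real.log R < 0 := fun r h0 h =>
    sub_neg.2 (Real.log_lt_log h0 h)
  have hS0 : ∀ r ∈ Set.Ioo 0 R, 0 ≤ S r := fun r hr =>
    div_nonneg_of_nonpos (sub_nonpos.2 (hmono r hr.1 hr.2)) (hneg r hr.1 hr.2).le
  have hbdd : BddBelow (S '' Set.Ioo 0 R) := ⟨0, by rintro _ ⟨r, hr, rfl⟩; exact hS0 r hr⟩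
  have hSm : MonotoneOn S (Set.Ioo 0 R) := fun r₁ h₁ r h hle => hconv r₁ r h₁.1 hle h.2
  have hne : (Set.Ioo 0 R).Nonempty := ⟨R / 2, by positivity, by linarith⟩
  have hlim := hSm.tendsto_nhdsWithin_Ioo_right hne hbdd
  refine ⟨sInf (S '' Set.Ioo 0 R), ?_, ?_, ?_⟩
  · refine le_csInf (hne.image _) ?_
    rintro _ ⟨r, hr, rfl⟩; exact hS0 r hr
  · have hlog : Tendsto (fun r => (Real.log r)⁻¹) (𝓝[>] 0) (𝓝 0) :=
      Real.tendsto_log_nhdsGT_zero.inv_tendsto_atBot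
    have h1 := (hlim.mul ((hlog.const_mul (Real.log R)).const_sub 1)).add (hlog.const_mul (m R))
    simp only [mul_zero, sub_zero, mul_one, add_zero] at h1
    refine h1.congr' ?_
    filter_upwards [Ioo_mem_nhdsGT (lt_min hR one_pos)] with r hr
    have h2 := hneg r hr.1 (hr.2.trans_le (min_le_left _ _))
    have h3 : Real.log r < 0 := Real.log_neg hr.1 (hr.2.trans_le (min_le_right _ _))
    simp only [hS]
    field_simp [h2.ne, h3.ne]
    ring
  · intro r h0 h
    have h1 : sInf (S '' Set.Ioo 0 R) ≤ S r := csInf_le hbdd ⟨r, ⟨h0, h⟩, rfl⟩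
    have h2 := hneg r h0 h
    simp only [hS] at h1
    rw [le_div_iff_of_neg h2] at h1
    linarith

section circleMax
variable {U : Set ℂ} {u : ℂ → EReal} {a : ℂ}

lemma SubharmonicOn.exists_bound (hu : SubharmonicOn u U) {R : ℝ}
    (hR : Metric.closedBall a R ⊆ U) : ∃ C : ℝ, ∀ z ∈ Metric.closedBall a R, u z ≤ C := by
  rcases (Metric.closedBall a R).eq_empty_or_nonempty with h | h
  · exact ⟨0, by simp [h]⟩
  obtain ⟨z, hz, hmax⟩ := (hu.upperSemicontinuousOn.mono hR).exists_isMaxOn h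
    (isCompact_closedBall a R)
  exact ⟨(u z).toReal, fun w hw => (hmax hw).trans (EReal.le_coe_toReal (hu.lt_top z (hR hz)).ne)⟩

/-- Semicontinuity gives a maximum point on the circle. If the maximum were `-∞`, comparison with
arbitrarily negative constants would force `u = -∞` on the whole disc. -/
lemma SubharmonicOn.circleMax_spec (hu : SubharmonicOn u U) (hne : ¬ ∀ᶠ z in 𝓝 a, u z = ⊥)
    {r : ℝ} (hr : 0 < r) (hrU : Metric.closedBall a r ⊆ U) :
    circleMax u a r = ((circleMax u a r).toReal : EReal) ∧
      (∃ z ∈ Metric.sphere a r, u z = ((circleMax u a r).toReal : EReal)) ∧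
      ∀ z ∈ Metric.closedBall a r, u z ≤ ((circleMax u a r).toReal : EReal) := by
  have hsU : Metric.sphere a r ⊆ U := Metric.sphere_subset_closedBall.trans hrU
  obtain ⟨z, hz, hmax⟩ := (hu.upperSemicontinuousOn.mono hsU).exists_isMaxOn
    (NormedSpace.sphere_nonempty.2 hr.le) (isCompact_sphere a r)
  have hM : circleMax u a r = u z :=
    le_antisymm (iSup₂_le fun w hw => hmax hw) (le_iSup₂_of_le z hz le_rfl)
  have hle : ∀ c : ℝ, u z ≤ c → ∀ w ∈ Metric.closedBall a r, u w ≤ c := fun c hc =>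
    hu.le_of_le_boundary (F := Metric.sphere a r) (h := fun _ => c) (isCompact_closedBall a r) hrU
      continuousOn_const (fun w hw hwF => ⟨mem_of_superset (Metric.isOpen_ball.mem_nhds
        (lt_of_le_of_ne hw hwF : w ∈ Metric.ball a r)) Metric.ball_subset_closedBall,
        InnerProductSpace.harmonicAt_const c⟩)
      (fun w _ hwF => (hmax hwF).trans hc)
  have hbot : u z ≠ ⊥ := by
    intro hb
    refine hne ?_
    filter_upwards [Metric.closedBall_mem_nhds a hr] with w hw
    refine EReal.eq_bot_iff_forall_lt _ |>.2 fun c => ?_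
    refine (hle (c - 1) (by simp [hb]) w hw).trans_lt ?_
    exact_mod_cast sub_one_lt c
  have hreal : (((circleMax u a r).toReal : ℝ) : EReal) = u z := by
    rw [hM, EReal.coe_toReal (hu.lt_top z (hsU hz)).ne hbot]
  refine ⟨hM.trans hreal.symm, ⟨z, hz, hreal.symm⟩, hle _ hreal.ge⟩

/-- Hadamard's three circles theorem: on the annulus, `u` is compared with the affine function of
`log |z - a|` that equals the maxima of `u` on the two bounding circles. -/
lemma SubharmonicOn.circleMax_logConvex (hu : SubharmonicOn u U)
    (hne : ¬ ∀ᶠ z in 𝓝 a, u z = ⊥) {r₁ r R : ℝ} (hr₁ : 0 < r₁) (hr : r₁ ≤ r) (hrR : r < R)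
    (hRU : Metric.closedBall a R ⊆ U) :
    ((circleMax u a r₁).toReal - (circleMax u a R).toReal) / (Real.log r₁ - Real.log R) ≤
      ((circleMax u a r).toReal - (circleMax u a R).toReal) / (Real.log r - Real.log R) := by
  set m : ℝ → ℝ := fun r => (circleMax u a r).toReal with hm
  have hspec : ∀ s, 0 < s → s ≤ R → _ := fun s hs hsR =>
    hu.circleMax_spec hne hs ((Metric.closedBall_subset_closedBall hsR).trans hRU)
  have hr0 : 0 < r := hr₁.trans_le hr
  have hlog : Real.log r - Real.log R < 0 := sub_neg.2 (Real.log_lt_log hr0 hrR)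
  have hlog₁ : Real.log r₁ - Real.log R < 0 := sub_neg.2 (Real.log_lt_log hr₁ (hr.trans_lt hrR))
  set α := (m r₁ - m R) / (Real.log r₁ - Real.log R) with hα
  set h : ℂ → ℝ := fun z => m R + α * (Real.log ‖z - a‖ - Real.log R) with hh
  set K := Metric.closedBall a R \ Metric.ball a r₁ with hK
  have hKne : ∀ z ∈ K, z - a ≠ 0 := fun z hz h0 => hz.2 (by
    rw [sub_eq_zero.1 h0]; exact Metric.mem_ball_self hr₁)
  obtain ⟨z, hz, hzm⟩ := (hspec r hr0 hrR.le).2.1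
  have hzn : ‖z - a‖ = r := by simpa [dist_eq_norm] using hz
  have hmax := hu.le_of_le_boundary (K := K) (F := {z | ‖z - a‖ = r₁ ∨ ‖z - a‖ = R}) (h := h)
    ((isCompact_closedBall a R).diff Metric.isOpen_ball) (Set.sdiff_subset.trans hRU)
    (by
      refine ContinuousOn.add continuousOn_const (ContinuousOn.mul continuousOn_const
        (ContinuousOn.sub (ContinuousOn.log (by fun_prop) fun z hz => ?_) continuousOn_const))
      exact norm_ne_zero_iff.2 (hKne z hz))
    (by
      intro w hw hwF
      have h1 : r₁ ≤ ‖w - a‖ ∧ ‖w - a‖ ≤ R := by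
        refine ⟨?_, ?_⟩
        · simpa [dist_eq_norm] using hw.2
        · simpa [dist_eq_norm] using hw.1
      rw [Set.mem_ofPred_eq, not_or] at hwF
      refine ⟨?_, ?_⟩
      · have h2 : {x : ℂ | r₁ < ‖x - a‖ ∧ ‖x - a‖ < R} ∈ 𝓝 w := by
          refine IsOpen.mem_nhds (IsOpen.and (isOpen_lt (by fun_prop) (by fun_prop))
            (isOpen_lt (by fun_prop) (by fun_prop))) ?_
          exact ⟨lt_of_le_of_ne h1.1 (Ne.symm hwF.1), lt_of_le_of_ne h1.2 hwF.2⟩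
        refine mem_of_superset h2 fun x hx => ⟨?_, ?_⟩
        · simpa [dist_eq_norm] using hx.2.le
        · simpa [dist_eq_norm] using hx.1.le
      · have h3 : InnerProductSpace.HarmonicAt (fun z : ℂ => Real.log ‖z - a‖) w :=
          AnalyticAt.harmonicAt_log_norm (f := fun z => z - a) (by fun_prop) (hKne w hw)
        exact (InnerProductSpace.harmonicAt_const _).add
          ((h3.sub (InnerProductSpace.harmonicAt_const _)).const_smul (c := α)))
    (by
      rintro w hw (hw1 | hwR)
      · have := (hspec r₁ hr₁ (hr.trans hrR.le)).2.2 w (by simp [dist_eq_norm, hw1])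
        refine this.trans (le_of_eq ?_)
        simp only [hh, hw1, hα]
        rw [div_mul_cancel₀ _ hlog₁.ne]
        simp [hm]
      · have := (hspec R (hr0.trans hrR) le_rfl).2.2 w (by simp [dist_eq_norm, hwR])
        refine this.trans (le_of_eq ?_)
        simp [hh, hwR, hm])
    z (by
      refine ⟨?_, ?_⟩
      · simp [dist_eq_norm, hzn, hrR.le]
      · simp [dist_eq_norm, hzn, hr])
  rw [hzm, EReal.coe_le_coe_iff] at hmax
  simp only [hh, hzn] at hmax
  rw [le_div_iff_of_neg hlog]
  change m r - m R ≤ _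
  change m r ≤ _ at hmax
  linarith

lemma SubharmonicOn.exists_lelong (hu : SubharmonicOn u U) (hne : ¬ ∀ᶠ z in 𝓝 a, u z = ⊥)
    {R : ℝ} (hR : 0 < R) (hRU : Metric.closedBall a R ⊆ U) :
    ∃ ν : ℝ, 0 ≤ ν ∧
      Tendsto (fun r => (circleMax u a r).toReal / Real.log r) (𝓝[>] 0) (𝓝 ν) ∧
      ∀ z ∈ Metric.ball a R, z ≠ a → u z ≤
        (((circleMax u a R).toReal + ν * (Real.log ‖z - a‖ - Real.log R) : ℝ) : EReal) := by
  obtain ⟨ν, h0, hlim, hle⟩ := exists_slope_of_logConvex (m := fun r => (circleMax u a r).toReal)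
    hR (fun r hr hrR => by
      obtain ⟨z, hz, hzm⟩ := (hu.circleMax_spec hne hr
        ((Metric.closedBall_subset_closedBall hrR.le).trans hRU)).2.1
      have := (hu.circleMax_spec hne hR hRU).2.2 z
        (Metric.closedBall_subset_closedBall hrR.le (Metric.sphere_subset_closedBall hz))
      rw [hzm] at this
      exact_mod_cast this)
    (fun r₁ r h₁ hr hrR => hu.circleMax_logConvex hne h₁ hr hrR hRU)
  refine ⟨ν, h0, hlim, fun z hz hza => ?_⟩
  have hz0 : 0 < ‖z - a‖ := norm_pos_iff.2 (sub_ne_zero.2 hza)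
  have hzR : ‖z - a‖ < R := by rw [← dist_eq_norm]; exact hz
  refine ((hu.circleMax_spec hne hz0
    ((Metric.closedBall_subset_closedBall hzR.le).trans hRU)).2.2 z ?_).trans ?_
  · simp [dist_eq_norm]
  · exact_mod_cast hle _ hz0 hzR

end circleMax

/-! ### Non-integrability when the Lelong number is large -/

lemma lintegral_ball_norm_neg_two (a : ℂ) {δ : ℝ} (hδ : 0 < δ) :
    ∫⁻ z in Metric.ball a δ, ENNReal.ofReal (‖z - a‖ ^ (-2 : ℝ)) = ⊤ := by
  rw [lintegral_ball_eq_polar (by fun_prop)]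
  have h1 : ∀ s ∈ Set.Ioo 0 δ, ENNReal.ofReal s * ∫⁻ t in Set.Ioc 0 (2 * Real.pi),
      ENNReal.ofReal (‖circleMap a s t - a‖ ^ (-2 : ℝ)) =
      ENNReal.ofReal (2 * Real.pi) * ENNReal.ofReal (s ^ (-1 : ℝ)) := by
    intro s hs
    have hs0 := hs.1
    simp only [circleMap_sub_center, norm_circleMap_zero, abs_of_pos hs0, lintegral_const,
      Measure.restrict_apply_univ, Real.volume_Ioc, sub_zero]
    rw [← ENNReal.ofReal_mul (by positivity), ← ENNReal.ofReal_mul hs0.le,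
      ← ENNReal.ofReal_mul (by positivity), show (-1 : ℝ) = 1 + (-2) by norm_num,
      Real.rpow_add hs0, Real.rpow_one]
    congr 1
    ring
  rw [setLIntegral_congr_fun measurableSet_Ioo h1, lintegral_const_mul _ (by fun_prop)]
  have h2 : ∫⁻ s in Set.Ioo 0 δ, ENNReal.ofReal (s ^ (-1 : ℝ)) = ⊤ := by
    by_contra hne
    have h3 : IntegrableOn (fun s : ℝ => s ^ (-1 : ℝ)) (Set.Ioo 0 δ) := by
      refine ⟨by fun_prop, ?_⟩
      rw [hasFiniteIntegral_iff_ofReal]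
      · exact lt_top_iff_ne_top.2 hne
      · exact (ae_restrict_iff' measurableSet_Ioo).2
          (ae_of_all _ fun s hs => Real.rpow_nonneg hs.1.le _)
    have := (intervalIntegral.integrableOn_Ioo_rpow_iff hδ).1 h3
    exact lt_irrefl _ this
  rw [h2, ENNReal.mul_top]
  have : 0 < 2 * Real.pi := by positivity
  simpa only [ne_eq, ENNReal.ofReal_eq_zero, not_le] using this

lemma ofReal_exp_le_exp_neg_div {x : EReal} {b t : ℝ} (ht : 0 < t) (h : x ≤ b) :
    ENNReal.ofReal (Real.exp (-(2 * b) / t)) ≤ (-(2 * x) / (t : EReal)).exp := by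
  have h1 : ((-(2 * b) / t : ℝ) : EReal) ≤ -(2 * x) / (t : EReal) := by
    rw [EReal.coe_div, EReal.coe_neg, EReal.coe_mul]
    refine EReal.div_le_div_right_of_nonneg (by exact_mod_cast ht.le) ?_
    refine EReal.neg_le_neg_iff.2 ?_
    exact mul_le_mul_of_nonneg_left h (by norm_num)
  rw [← EReal.exp_coe]
  exact EReal.exp_monotone h1

lemma exp_neg_div_eq {x : EReal} {C t : ℝ} (ht : 0 < t) (h : x ≤ C) :
    (-(2 * x) / (t : EReal)).exp =
      ENNReal.ofReal (Real.exp (-(2 * C) / t)) * expPow (2 / t) ((C : EReal) - x).toENNReal := by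
  induction x with
  | bot =>
    have h1 : (C : EReal) - ⊥ = ⊤ := by simp [sub_eq_add_neg]
    have h2 : (2 : EReal) * ⊥ = ⊥ := EReal.mul_bot_of_pos (by norm_num)
    rw [h1, EReal.toENNReal_top, expPow_top (by positivity), h2, EReal.neg_bot,
      EReal.top_div_of_pos_ne_top (by exact_mod_cast ht) (by simp), EReal.exp_top,
      ENNReal.mul_top]
    simp [Real.exp_pos]
  | coe x =>
    have hx : x ≤ C := by exact_mod_cast h
    rw [← EReal.coe_sub, EReal.real_coe_toENNReal, expPow_ofReal (sub_nonneg.2 hx),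
      ← ENNReal.ofReal_mul (Real.exp_pos _).le, ← Real.exp_add]
    have : -(2 * (x : EReal)) / (t : EReal) = ((-(2 * x) / t : ℝ) : EReal) := by
      rw [EReal.coe_div, EReal.coe_neg, EReal.coe_mul]; rfl
    rw [this, EReal.exp_coe]
    congr 2
    field_simp
    ring
  | top => exact absurd h (by simp)

section
variable {U : Set ℂ} {u : ℂ → EReal} {a : ℂ}

/-- If `ν ≥ t`, the logarithmic upper bound for `u` makes the integrand at least a multiple of `|z -
a|^{-2}` near `a`. Divergence at exactly this exponent excludes the case `ν = t` too. -/
lemma lelong_lt_of_integrableNear {R A ν t : ℝ}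
    (ht : 0 < t) (hR : 0 < R)
    (hle : ∀ z ∈ Metric.ball a R, z ≠ a → u z ≤ ((A + ν * Real.log ‖z - a‖ : ℝ) : EReal))
    (hint : IntegrableNear (fun z => (-(2 * u z) / (t : EReal)).exp) a) : ν < t := by
  by_contra! hν
  obtain ⟨V, hV, hVi⟩ := hint
  obtain ⟨ε, hε, hεV⟩ := Metric.mem_nhds_iff.1 hV
  -- The radius is at most `1` so that `log |z - a| ≤ 0`, which turns `ν ≥ t` into the required
  -- inequality of exponents.
  set δ := min (min ε R) 1 with hδ
  have hδ0 : 0 < δ := lt_min (lt_min hε hR) one_pos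
  have h1 : ∀ z ∈ Metric.ball a δ, z ≠ a →
      ENNReal.ofReal (Real.exp (-(2 * A) / t)) * ENNReal.ofReal (‖z - a‖ ^ (-2 : ℝ)) ≤
        (-(2 * u z) / (t : EReal)).exp := by
    intro z hz hza
    have hz0 : 0 < ‖z - a‖ := norm_pos_iff.2 (sub_ne_zero.2 hza)
    have hzδ : ‖z - a‖ < δ := by rw [← dist_eq_norm]; exact hz
    have hz1 : ‖z - a‖ ≤ 1 := (hzδ.trans_le (min_le_right _ _)).le
    have hzR : z ∈ Metric.ball a R :=
      Metric.ball_subset_ball ((min_le_left _ _).trans (min_le_right _ _)) hz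
    refine le_trans ?_ (ofReal_exp_le_exp_neg_div ht (hle z hzR hza))
    rw [← ENNReal.ofReal_mul (Real.exp_pos _).le, Real.rpow_def_of_pos hz0, ← Real.exp_add]
    refine ENNReal.ofReal_le_ofReal (Real.exp_le_exp.2 ?_)
    have hlog : Real.log ‖z - a‖ ≤ 0 := Real.log_nonpos hz0.le hz1
    rw [← sub_nonneg]
    have : -(2 * (A + ν * Real.log ‖z - a‖)) / t - (-(2 * A) / t + Real.log ‖z - a‖ * -2) =
        2 * (ν - t) * (-Real.log ‖z - a‖) / t := by field_simp; ring
    rw [this]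
    exact div_nonneg (mul_nonneg (by linarith) (by linarith)) ht.le
  have h2 : (⊤ : ENNReal) ≤ ∫⁻ z in V, (-(2 * u z) / (t : EReal)).exp := by
    calc (⊤ : ENNReal) = ENNReal.ofReal (Real.exp (-(2 * A) / t)) *
          ∫⁻ z in Metric.ball a δ, ENNReal.ofReal (‖z - a‖ ^ (-2 : ℝ)) := by
          rw [lintegral_ball_norm_neg_two a hδ0, ENNReal.mul_top]
          simp [Real.exp_pos]
      _ = ∫⁻ z in Metric.ball a δ, ENNReal.ofReal (Real.exp (-(2 * A) / t)) *
          ENNReal.ofReal (‖z - a‖ ^ (-2 : ℝ)) := by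
          rw [lintegral_const_mul _ (by fun_prop)]
      _ ≤ ∫⁻ z in Metric.ball a δ, (-(2 * u z) / (t : EReal)).exp := by
          refine lintegral_mono_ae ((ae_restrict_iff' measurableSet_ball).2 ?_)
          filter_upwards [compl_mem_ae_iff.2 (measure_singleton a)] with z hza hz
          exact h1 z hz hza
      _ ≤ _ := lintegral_mono_set
          ((Metric.ball_subset_ball ((min_le_left _ _).trans (min_le_left _ _))).trans hεV)
  exact absurd hVi (not_lt.2 h2)

/-! ### Integrability when the Lelong number is small -/

/-- The superharmonic function `C - u` on the disc of radius `R` about `a`, extended by `0`. -/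
noncomputable def truncCompl (u : ℂ → EReal) (a : ℂ) (R C : ℝ) : ℂ → ENNReal :=
  (Metric.ball a R).indicator fun z => ((C : EReal) - u z).toENNReal

variable {R C : ℝ}

lemma SubharmonicOn.lowerSemicontinuous_truncCompl (hu : SubharmonicOn u U)
    (hR : Metric.ball a R ⊆ U) : LowerSemicontinuous (truncCompl u a R C) := by
  intro z c hc
  by_cases hz : z ∈ Metric.ball a R
  · unfold truncCompl at hc
    rw [Set.indicator_of_mem hz] at hc
    have h1 := UpperSemicontinuousWithinAt.const_sub_toENNReal
      (hu.upperSemicontinuousOn.mono hR z hz) C c hc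
    rw [Metric.isOpen_ball.nhdsWithin_eq hz] at h1
    filter_upwards [h1, Metric.isOpen_ball.mem_nhds hz] with y hy hyb
    unfold truncCompl
    rwa [Set.indicator_of_mem hyb]
  · unfold truncCompl at hc
    rw [Set.indicator_of_notMem hz] at hc
    exact absurd hc not_lt_zero

lemma SubharmonicOn.lintegral_ball_truncCompl_le (hu : SubharmonicOn u U)
    (hRU : Metric.ball a R ⊆ U) (hC : ∀ z ∈ Metric.ball a R, u z ≤ C) {w : ℂ} {r : ℝ}
    (hr : 0 ≤ r) (hw : Metric.ball w r ⊆ Metric.ball a R) :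
    ∫⁻ y in Metric.ball w r, truncCompl u a R C y ≤
      ENNReal.ofReal (Real.pi * r ^ 2) * ((C : EReal) - u w).toENNReal := by
  refine lintegral_ball_le_of_circle (hu.lowerSemicontinuous_truncCompl hRU).measurable hr
    fun s hs => ?_
  have h1 : Metric.closedBall w s ⊆ Metric.ball a R :=
    (Metric.closedBall_subset_ball hs.2).trans hw
  refine (lintegral_mono fun t => ?_).trans
    (hu.lintegral_circle_le hs.1 (h1.trans hRU) fun z hz => hC z (h1 hz))
  exact Set.indicator_le_self _ _ _

lemma SubharmonicOn.discAvg_truncCompl_le (hu : SubharmonicOn u U)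
    (hRU : Metric.ball a R ⊆ U) (hC : ∀ z ∈ Metric.ball a R, u z ≤ C) {w : ℂ} {r : ℝ}
    (hr : 0 < r) (hw : Metric.ball w r ⊆ Metric.ball a R) :
    discAvg r (truncCompl u a R C) w ≤ truncCompl u a R C w := by
  have h0 : ENNReal.ofReal (Real.pi * r ^ 2) ≠ 0 := by
    have : 0 < Real.pi * r ^ 2 := by positivity
    simpa using this
  unfold discAvg
  calc _ ≤ (ENNReal.ofReal (Real.pi * r ^ 2))⁻¹ *
        (ENNReal.ofReal (Real.pi * r ^ 2) * ((C : EReal) - u w).toENNReal) := by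
        gcongr
        exact hu.lintegral_ball_truncCompl_le hRU hC hr.le hw
    _ = _ := by
        rw [← mul_assoc, ENNReal.inv_mul_cancel h0 ENNReal.ofReal_ne_top, one_mul, truncCompl,
          Set.indicator_of_mem (hw (Metric.mem_ball_self hr))]

/-- Disc averages of `C - u` are controlled by the maximum of `u` on a smaller circle. -/
lemma SubharmonicOn.lintegral_truncCompl_le_circleMax (hu : SubharmonicOn u U)
    (hne : ¬ ∀ᶠ z in 𝓝 a, u z = ⊥)
    (hRU : Metric.ball a R ⊆ U) (hC : ∀ z ∈ Metric.ball a R, u z ≤ C) {s l : ℝ} (hs : 0 < s)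
    (hl : 0 < l) (hls : (1 + 2 * l) * s < R) :
    ∫⁻ y in Metric.ball a s, truncCompl u a R C y ≤
      ENNReal.ofReal (Real.pi * ((1 + l) * s) ^ 2) *
        ENNReal.ofReal (C - (circleMax u a (l * s)).toReal) := by
  have hls0 : 0 < l * s := by positivity
  -- The disc about `a` lies in the disc of radius `(1 + l) * s` about a maximum point `z` of the
  -- small circle. The super-mean inequality centred at `z` then costs only the area factor `(1 +
  -- l)²`.
  obtain ⟨z, hz, hzm⟩ := (hu.circleMax_spec hne hls0
    ((Metric.closedBall_subset_ball (by nlinarith)).trans hRU)).2.1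
  have hz' : dist z a = l * s := hz
  calc _ ≤ ∫⁻ y in Metric.ball z ((1 + l) * s), truncCompl u a R C y := by
        refine lintegral_mono_set (Metric.ball_subset_ball' ?_)
        rw [dist_comm, hz']; linarith
    _ ≤ _ := by
        refine (hu.lintegral_ball_truncCompl_le hRU hC (by positivity)
          (Metric.ball_subset_ball' (by rw [hz']; linarith))).trans ?_
        rw [hzm, ← EReal.coe_sub, EReal.real_coe_toENNReal]

/-- The exponent `4` is the total area loss: one factor `(1 + l)²` for enlarging `R₂` to `R₂ + η`
with `η = l * R₂`, another for moving the centre to a maximum point. -/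
lemma exists_pow_mul_lt {ν θ : ℝ} (h : ν < θ) : ∃ l : ℝ, 0 < l ∧ l ≤ 1 ∧ (1 + l) ^ 4 * ν < θ := by
  have h1 : Tendsto (fun l : ℝ => (1 + l) ^ 4 * ν) (𝓝[>] 0) (𝓝 ((1 + 0) ^ 4 * ν)) :=
    ((by fun_prop : Continuous fun l : ℝ => (1 + l) ^ 4 * ν).tendsto 0).mono_left
      nhdsWithin_le_nhds
  have h2 := h1.eventually_lt_const (by simpa using h)
  obtain ⟨l, hl, hl0, hl1⟩ := (h2.and (Ioc_mem_nhdsGT one_pos)).exists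
  exact ⟨l, hl0, hl1, hl⟩

/-- After division by `-log r`, the left side tends to `k * ν` and the right side to `θ`; the
constants `C` and `D` disappear in the limit. -/
lemma eventually_mul_sub_le_log {m : ℝ → ℝ} {ν θ k : ℝ}
    (hlim : Tendsto (fun r => m r / Real.log r) (𝓝[>] 0) (𝓝 ν)) (h : k * ν < θ) (C D : ℝ) :
    ∀ᶠ r in 𝓝[>] 0, k * (C - m r) ≤ θ * (D - Real.log r) := by
  have hlog : Tendsto (fun r => (Real.log r)⁻¹) (𝓝[>] 0) (𝓝 0) :=
    Real.tendsto_log_nhdsGT_zero.inv_tendsto_atBot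
  have h1 := (hlim.const_mul k).add (hlog.const_mul (θ * D - k * C))
  simp only [mul_zero, add_zero] at h1
  filter_upwards [h1.eventually_lt_const h, Ioo_mem_nhdsGT one_pos] with r hr hr1
  have h3 : Real.log r < 0 := Real.log_neg hr1.1 hr1.2
  have h4 : k * (m r / Real.log r) + (θ * D - k * C) * (Real.log r)⁻¹ =
      (k * m r + (θ * D - k * C)) / Real.log r := by field_simp
  rw [h4, div_lt_iff_of_neg h3] at hr
  linarith

lemma SubharmonicOn.integrableNear_of_lelong_lt (hu : SubharmonicOn u U)
    (hne : ¬ ∀ᶠ z in 𝓝 a, u z = ⊥) (hR : 0 < R) (hRU : Metric.closedBall a R ⊆ U) {ν t : ℝ}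
    (hν : 0 ≤ ν)
    (hlim : Tendsto (fun r => (circleMax u a r).toReal / Real.log r) (𝓝[>] 0) (𝓝 ν))
    (hνt : ν < t) : IntegrableNear (fun z => (-(2 * u z) / (t : EReal)).exp) a := by
  have ht : 0 < t := hν.trans_lt hνt
  obtain ⟨C, hC⟩ := hu.exists_bound hRU
  obtain ⟨θ, hνθ, hθt⟩ := exists_between hνt
  have hθ : 0 < θ := hν.trans_lt hνθ
  obtain ⟨l, hl, hl1, hlν⟩ := exists_pow_mul_lt hνθ
  -- Small enough for the disc estimate with `l = 1`, which needs `3 * R' < R`, to show that `f` has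
  -- finite integral.
  set R' := R / 4 with hR'
  have hR'0 : 0 < R' := by positivity
  have hbR : Metric.ball a R ⊆ U := Metric.ball_subset_closedBall.trans hRU
  have hbR' : Metric.ball a R' ⊆ Metric.ball a R := Metric.ball_subset_ball (by linarith)
  have hCR : ∀ z ∈ Metric.ball a R, u z ≤ C := fun z hz => hC z (Metric.ball_subset_closedBall hz)
  set f := truncCompl u a R' C with hf
  have hlsc : LowerSemicontinuous f := hu.lowerSemicontinuous_truncCompl (hbR'.trans hbR)
  have hfle : ∀ z, f z ≤ truncCompl u a R C z := fun z =>
    Set.indicator_le_indicator_of_subset hbR' (fun _ => zero_le) z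
  have hfi : ∫⁻ z, f z < ⊤ := by
    calc ∫⁻ z, f z = ∫⁻ z in Metric.ball a R', ((C : EReal) - u z).toENNReal := by
          rw [hf, truncCompl, lintegral_indicator measurableSet_ball]
      _ = ∫⁻ z in Metric.ball a R', truncCompl u a R C z := by
          refine setLIntegral_congr_fun measurableSet_ball fun z hz => ?_
          simp only [truncCompl]
          rw [Set.indicator_of_mem (hbR' hz)]
      _ ≤ _ := hu.lintegral_truncCompl_le_circleMax hne hbR hCR hR'0 one_pos (by linarith)
      _ < ⊤ := ENNReal.mul_lt_top ENNReal.ofReal_lt_top ENNReal.ofReal_lt_top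
  set R₁ := R' / 2 with hR₁
  have hR₁0 : 0 < R₁ := by positivity
  -- The average over radius `(1 + l) * R₂` is controlled by the maximum of `u` at radius `l * (1 +
  -- l) * R₂ = κ * R₂`. The asymptotics of `M` are therefore applied at `κ * R₂`, and `log κ` is
  -- absorbed in the constant.
  set κ := l * (1 + l) with hκ
  have hκ0 : 0 < κ := by positivity
  have hev := eventually_mul_sub_le_log hlim hlν C (Real.log R₁ - 1 + Real.log κ)
  have hκt : Tendsto (fun r : ℝ => κ * r) (𝓝[>] 0) (𝓝[>] 0) := by
    refine tendsto_nhdsWithin_iff.2 ⟨?_, ?_⟩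
    · have : Tendsto (fun r : ℝ => κ * r) (𝓝 0) (𝓝 (κ * 0)) := by
        exact (continuous_const_mul κ).tendsto 0
      rw [mul_zero] at this
      exact this.mono_left nhdsWithin_le_nhds
    · filter_upwards [self_mem_nhdsWithin] with r hr
      exact mul_pos hκ0 hr
  -- The bound `R₂ < R₁ / e²` keeps `log (R₁ / R₂) - 1` positive, as the mass estimate requires.
  obtain ⟨R₂, hR₂ev, hR₂0, hR₂lt⟩ := ((hκt.eventually hev).and
    (Ioo_mem_nhdsGT (by positivity : 0 < R₁ / Real.exp 2))).exists
  have hR₂R₁ : R₂ < R₁ := hR₂lt.trans (div_lt_self hR₁0 (Real.one_lt_exp_iff.2 (by norm_num)))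
  have hlog : 1 < Real.log R₁ - Real.log R₂ := by
    have := Real.log_lt_log hR₂0 hR₂lt
    rw [Real.log_div hR₁0.ne' (Real.exp_ne_zero _), Real.log_exp] at this
    linarith
  have hlR₂ : l * R₂ ≤ R₂ := by nlinarith
  rw [Real.log_mul hκ0.ne' hR₂0.ne'] at hR₂ev
  have hmain := lintegral_expPow_lt_top (f := f) (a := a) (R₁ := R₁) (R₂ := R₂) (η := l * R₂)
    (γ := 2 / t) (θ := θ) hlsc.measurable hfi hR₂0 hR₂R₁.le (by positivity) hlog
    (fun w hw ρ hρ hρη => hu.discAvg_truncCompl_le (hbR'.trans hbR)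
      (fun z hz => hCR z (hbR' hz)) hρ (Metric.ball_subset_ball' (by
        have : dist w a < R₁ := hw
        linarith)))
    (fun z _ => hlsc z) (by positivity) hθ
    -- The decisive exponent condition `(2 / t) * θ < 2`, which is `θ < t`.
    (by rw [div_mul_eq_mul_div, div_lt_iff₀ ht]; linarith) (by
      have h1 : ∫⁻ w in Metric.ball a (R₂ + l * R₂), f w ≤
          ENNReal.ofReal (Real.pi * ((1 + l) * (R₂ + l * R₂)) ^ 2) *
            ENNReal.ofReal (C - (circleMax u a (l * (R₂ + l * R₂))).toReal) := by
        refine (lintegral_mono fun z => hfle z).trans ?_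
        refine hu.lintegral_truncCompl_le_circleMax hne hbR hCR (by positivity) hl ?_
        nlinarith
      have hp : 0 < Real.pi * R₂ ^ 2 := by positivity
      refine (mul_le_mul_right h1 _).trans ?_
      rw [← ENNReal.ofReal_inv_of_pos hp, ← mul_assoc, ← ENNReal.ofReal_mul (by positivity),
        ← ENNReal.ofReal_mul (by positivity)]
      refine ENNReal.ofReal_le_ofReal ?_
      have h2 : (Real.pi * R₂ ^ 2)⁻¹ * (Real.pi * ((1 + l) * (R₂ + l * R₂)) ^ 2) =
          (1 + l) ^ 4 := by field_simp
      have h3 : l * (R₂ + l * R₂) = κ * R₂ := by rw [hκ]; ring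
      rw [h2, h3]
      exact hR₂ev.trans (le_of_eq (by ring)))
  refine ⟨Metric.ball a (R₂ / 4), Metric.ball_mem_nhds a (by positivity), ?_⟩
  have hsub : Metric.ball a (R₂ / 4) ⊆ Metric.ball a R' := Metric.ball_subset_ball (by linarith)
  calc ∫⁻ z in Metric.ball a (R₂ / 4), (-(2 * u z) / (t : EReal)).exp
      = ∫⁻ z in Metric.ball a (R₂ / 4),
          ENNReal.ofReal (Real.exp (-(2 * C) / t)) * expPow (2 / t) (f z) := by
        refine setLIntegral_congr_fun measurableSet_ball fun z hz => ?_
        simp only [hf, truncCompl]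
        rw [exp_neg_div_eq ht (hCR z (hbR' (hsub hz))), Set.indicator_of_mem (hsub hz)]
    _ = ENNReal.ofReal (Real.exp (-(2 * C) / t)) *
          ∫⁻ z in Metric.ball a (R₂ / 4), expPow (2 / t) (f z) := by
        rw [lintegral_const_mul]
        exact continuous_expPow.measurable.comp hlsc.measurable
    _ < ⊤ := ENNReal.mul_lt_top ENNReal.ofReal_lt_top hmain

end

theorem mainTheorem8 (U : Set ℂ) (hU : IsOpen U) (a : ℂ) (ha : a ∈ U)
    (u : ℂ → EReal) (hu : SubharmonicOn u U) (hne : ¬ ∀ᶠ z in 𝓝 a, u z = ⊥) :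
    (Tendsto (fun r : ℝ => circleMax u a r / ((Real.log r : ℝ) : EReal)) (𝓝[>] (0 : ℝ))
        (𝓝 (lelongNumber u a)) ∧
      0 ≤ lelongNumber u a ∧ lelongNumber u a < ⊤) ∧
    integrabilityIndex u a = lelongNumber u a ∧
    (IntegrableNear (fun z => (-(2 * u z)).exp) a ↔ lelongNumber u a < 1) := by
  obtain ⟨R, hR, hRU⟩ := Metric.nhds_basis_closedBall.mem_iff.1 (hU.mem_nhds ha)
  obtain ⟨ν, hν, hlim, hle⟩ := hu.exists_lelong hne hR hRU
  have hT : Tendsto (fun r : ℝ => circleMax u a r / ((Real.log r : ℝ) : EReal)) (𝓝[>] (0 : ℝ))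
      (𝓝 (ν : EReal)) := by
    refine ((continuous_coe_real_ereal.tendsto ν).comp hlim).congr' ?_
    filter_upwards [Ioo_mem_nhdsGT hR] with r hr
    have := (hu.circleMax_spec hne hr.1
      ((Metric.closedBall_subset_closedBall hr.2.le).trans hRU)).1
    rw [Function.comp_apply, EReal.coe_div, ← this]
  have hL : lelongNumber u a = ν := hT.limUnder_eq
  -- The admissible exponents are exactly the `t > 0` with `ν < t`; both remaining claims follow
  -- from this.
  have hiff : ∀ t : ℝ, 0 < t →
      (IntegrableNear (fun z => (-(2 * u z) / (t : EReal)).exp) a ↔ ν < t) := fun t ht =>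
    ⟨lelong_lt_of_integrableNear ht hR
      (A := (circleMax u a R).toReal - ν * Real.log R) (fun z hz hza =>
        (hle z hz hza).trans (le_of_eq (by congr 1; ring))),
      hu.integrableNear_of_lelong_lt hne hR hRU hν hlim⟩
  rw [hL]
  refine ⟨⟨hT, by exact_mod_cast hν, EReal.coe_lt_top ν⟩, ?_, ?_⟩
  · refine le_antisymm ?_ (le_iInf₂ fun t ht => ?_)
    · refine EReal.le_of_forall_lt_iff_le.1 fun t ht => ?_
      have ht' : ν < t := by exact_mod_cast ht
      have ht0 := hν.trans_lt ht'
      exact iInf₂_le t ⟨ht0, (hiff t ht0).2 ht'⟩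
    · exact_mod_cast ((hiff t ht.1).1 ht.2).le
  · have := hiff 1 one_pos
    simp only [EReal.coe_one, div_one] at this
    rw [this]
    norm_cast
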